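/- Let $U_0=[0,1]^2$ and let $M_0$ be its boundary. A \emph{square set} is a set $X$ with an injective map $S_X:M_0\to X$; a morphism $f:X\to Y$ of the category $\mathsf{SquaSet}$ of square sets is a map with $f\circ S_X=S_Y$. A \emph{square metric space} is a square set $X$ which is a metric space with all distances at most $2$ such that $d_X(S_X(i,r),S_X(i,s))=|r-s|=d_X(S_X(r,i),S_X(s,i))$ for $i\in\{0,1\}$, $r,s\in[0,1]$, and $d_X(S_X(r,s),S_X(t,u))\ge|r-t|+|s-u|$ for all $(r,s),(t,u)\in M_0$; morphisms of the category $\mathsf{SquaMS}$ are the morphisms of square sets which are short, i.e. do not increase distances. Let $M=\{0,1,2\}^2\setminus\{(1,1)\}$ and $\sigma_m(p)=\frac13(m+p)$ for $m\in M$, $p\in U_0$. For a square set $X$ let $M\otimes X=(M\times X)/{\sim}$, where $\sim$ is the equivalence relation generated by gluing adjacent sides, i.e. for $r\in[0,1]$ by $((0,0),S_X(r,1))\sim((0,1),S_X(r,0))$, $((0,1),S_X(r,1))\sim((0,2),S_X(r,0))$, $((0,2),S_X(1,r))\sim((1,2),S_X(0,r))$, $((1,2),S_X(1,r))\sim((2,2),S_X(0,r))$,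 $((2,2),S_X(r,0))\sim((2,1),S_X(r,1))$, $((2,1),S_X(r,0))\sim((2,0),S_X(r,1))$, $((2,0),S_X(0,r))\sim((1,0),S_X(1,r))$, $((1,0),S_X(0,r))\sim((0,0),S_X(1,r))$. Write $m\otimes x$ for the class of $(m,x)$. Then $M\otimes X$ is a square set by $S_{M\otimes X}(\sigma_m(w))=m\otimes S_X(w)$ (for $m\in M$ and $w\in M_0$ with $\sigma_m(w)\in M_0$), and $M\otimes-$ is an endofunctor of $\mathsf{SquaSet}$ by $(M\otimes f)(m\otimes x)=m\otimes f(x)$. It is also an endofunctor of $\mathsf{SquaMS}$: the distance of $m\otimes x$ and $n\otimes y$ is the infimum of the scores of all finite paths in $M\times X$ from $(m,x)$ to $(n,y)$, where the score of a path is the sum of the contributions of its pairs of consecutive entries, and a pair $(k,a),(l,b)$ contributes $0$ if $(k,a)\sim(l,b)$, and otherwise $\frac13d_X(a,b)$ if $k=l$ and $2$ if $k\ne l$. Let $\mathbb S$ be the Sierpinski carpet, the unique non-empty compact subset of $U_0$ with $\mathbb S=\bigcup_{m\in M}\sigma_m(\mathbb S)$; it is a square set by the inclusion $M_0\subseteq\mathbb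 S$. The map $\tau:M\otimes\mathbb S\to\mathbb S$, $\tau(m\otimes s)=\sigma_m(s)$, is an isomorphism of square sets. Let $(G,\eta:M\otimes G\to G)$ be an initial algebra of $M\otimes-:\mathsf{SquaMS}\to\mathsf{SquaMS}$ (it is unique up to isomorphism, and $\eta$ is invertible), let $Q=C(G)$ be the Cauchy completion of $G$, with $S_Q$ the composite of $S_G$ with $G\to C(G)$, and let $\gamma:Q\to M\otimes Q$ be the composite of $C(\eta^{-1}):C(G)\to C(M\otimes G)$ with the inverse of the isomorphism $M\otimes C(G)\to C(M\otimes G)$, $m\otimes\lim_k x_k\mapsto\lim_k(m\otimes x_k)$. Then the following hold. 1. $(\mathbb S,\tau^{-1})$ is a final coalgebra of $M\otimes-:\mathsf{SquaSet}\to\mathsf{SquaSet}$. 2. An initial algebra $(G,\eta)$ as above exists, and (forgetting the metric) the resulting $(Q,\gamma)$ is a final coalgebra of $M\otimes-:\mathsf{SquaSet}\to\mathsf{SquaSet}$. -/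

import Mathlib

namespace SquareSets

open CategoryTheory
open scoped NNReal

noncomputable section

/-! ## The unit square, its boundary, and the eight contractions -/

/-- The unit square `U₀ = [0,1]²`. -/
def unitSquare : Set (ℝ × ℝ) := {p | p.1 ∈ Set.Icc (0 : ℝ) 1 ∧ p.2 ∈ Set.Icc (0 : ℝ) 1}

/-- The boundary `M₀` of the unit square. -/
def boundary : Set (ℝ × ℝ) :=
  {p | (p.1 = 0 ∨ p.1 = 1) ∧ p.2 ∈ Set.Icc (0 : ℝ) 1} ∪
    {p | p.1 ∈ Set.Icc (0 : ℝ) 1 ∧ (p.2 = 0 ∨ p.2 = 1)}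

/-- `M₀` as a type. -/
abbrev M0 : Type := boundary

/-- The point `(0, r)` of `M₀`. -/
def left (r : unitInterval) : M0 := ⟨(0, r), Or.inl ⟨Or.inl rfl, r.2⟩⟩

/-- The point `(1, r)` of `M₀`. -/
def right (r : unitInterval) : M0 := ⟨(1, r), Or.inl ⟨Or.inr rfl, r.2⟩⟩

/-- The point `(r, 0)` of `M₀`. -/
def bottom (r : unitInterval) : M0 := ⟨(r, 0), Or.inr ⟨r.2, Or.inl rfl⟩⟩

/-- The point `(r, 1)` of `M₀`. -/
def top (r : unitInterval) : M0 := ⟨(r, 1), Or.inr ⟨r.2, Or.inr rfl⟩⟩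

/-- The index set `M = {0,1,2}² \ {(1,1)}`; an index is a pair (column, row). -/
abbrev Idx : Type := {m : Fin 3 × Fin 3 // m ≠ (1, 1)}

/-- The contraction `σ_m(p) = shrink(m) + p/3`, where `shrink (i, j) = (i/3, j/3)`. -/
def contract (m : Idx) (p : ℝ × ℝ) : ℝ × ℝ :=
  (((m.1.1 : ℕ) : ℝ) / 3 + p.1 / 3, ((m.1.2 : ℕ) : ℝ) / 3 + p.2 / 3)

/-- The taxicab distance on the plane. -/
def taxi (p q : ℝ × ℝ) : ℝ := |p.1 - q.1| + |p.2 - q.2|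

/-- The generating identifications between points of `M × M₀`. -/
inductive Glue : Idx × M0 → Idx × M0 → Prop
  | g1 (r : unitInterval) : Glue (⟨(0, 0), by decide⟩, top r) (⟨(0, 1), by decide⟩, bottom r)
  | g2 (r : unitInterval) : Glue (⟨(0, 1), by decide⟩, top r) (⟨(0, 2), by decide⟩, bottom r)
  | g3 (r : unitInterval) : Glue (⟨(0, 2), by decide⟩, right r) (⟨(1, 2), by decide⟩, left r)
  | g4 (r : unitInterval) : Glue (⟨(1, 2), by decide⟩, right r) (⟨(2, 2), by decide⟩, left r)
  | g5 (r : unitInterval) : Glue (⟨(2, 2), by decide⟩, bottom r) (⟨(2, 1), by decide⟩, top r)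
  | g6 (r : unitInterval) : Glue (⟨(2, 1), by decide⟩, bottom r) (⟨(2, 0), by decide⟩, top r)
  | g7 (r : unitInterval) : Glue (⟨(2, 0), by decide⟩, left r) (⟨(1, 0), by decide⟩, right r)
  | g8 (r : unitInterval) : Glue (⟨(1, 0), by decide⟩, left r) (⟨(0, 0), by decide⟩, right r)

theorem boundary_subset : boundary ⊆ unitSquare := by
  rintro ⟨x, y⟩ (⟨h | h, h'⟩ | ⟨h', h | h⟩) <;> simp_all [unitSquare]

theorem contract_mem (m : Idx) {p : ℝ × ℝ} (hp : p ∈ unitSquare) : contract m p ∈ unitSquare := by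
  obtain ⟨⟨i, j⟩, hm⟩ := m
  obtain ⟨⟨h1, h2⟩, h3, h4⟩ := hp
  have hi : ((i : ℕ) : ℝ) ≤ 2 := by exact_mod_cast Nat.le_of_lt_succ i.2
  have hj : ((j : ℕ) : ℝ) ≤ 2 := by exact_mod_cast Nat.le_of_lt_succ j.2
  have hi0 : (0 : ℝ) ≤ ((i : ℕ) : ℝ) := Nat.cast_nonneg _
  have hj0 : (0 : ℝ) ≤ ((j : ℕ) : ℝ) := Nat.cast_nonneg _
  refine ⟨⟨?_, ?_⟩, ?_, ?_⟩ <;> simp only [contract] <;> linarith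

theorem Glue.contract_eq {p q : Idx × M0} (h : Glue p q) :
    contract p.1 p.2 = contract q.1 q.2 := by
  cases h <;> simp [contract, left, right, top, bottom] <;> norm_num

theorem contract_injective (m : Idx) : Function.Injective (contract m) := by
  intro p q h
  simp only [contract, Prod.mk.injEq] at h
  exact Prod.ext (by linarith [h.1]) (by linarith [h.2])

/-- Two coordinates in adjacent or equal columns (rows) of the grid. -/
theorem coord_cases {i k : Fin 3} {x t : ℝ} (hx : x ∈ Set.Icc (0 : ℝ) 1)
    (ht : t ∈ Set.Icc (0 : ℝ) 1)
    (h : ((i : ℕ) : ℝ) / 3 + x / 3 = ((k : ℕ) : ℝ) / 3 + t / 3) :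
    (i = k ∧ x = t) ∨ ((k : ℕ) = i + 1 ∧ x = 1 ∧ t = 0) ∨ ((i : ℕ) = k + 1 ∧ x = 0 ∧ t = 1) := by
  obtain ⟨hx0, hx1⟩ := hx
  obtain ⟨ht0, ht1⟩ := ht
  fin_cases i <;> fin_cases k <;> norm_num at h ⊢ <;>
    first | linarith | exact ⟨by linarith, by linarith⟩

open Relation in
theorem eqvGen_glue_iff {p q : Idx × M0} :
    EqvGen Glue p q ↔ contract p.1 p.2 = contract q.1 q.2 := by
  constructor
  · intro h
    induction h with
    | rel _ _ h => exact h.contract_eq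
    | refl _ => rfl
    | symm _ _ _ ih => exact ih.symm
    | trans _ _ _ _ _ ih1 ih2 => exact ih1.trans ih2
  · intro h
    obtain ⟨⟨⟨i, j⟩, hm⟩, ⟨⟨x, y⟩, hz⟩⟩ := p
    obtain ⟨⟨⟨k, l⟩, hn⟩, ⟨⟨t, u⟩, hw⟩⟩ := q
    have hz' := boundary_subset hz
    have hw' := boundary_subset hw
    simp only [contract, Prod.mk.injEq] at h
    have hs : ∀ {a b}, Glue a b → EqvGen Glue a b := fun h => EqvGen.rel _ _ h
    have hs' : ∀ {a b}, Glue a b → EqvGen Glue b a := fun h => EqvGen.symm _ _ (EqvGen.rel _ _ h)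
    have ht : ∀ {a b c}, EqvGen Glue a b → EqvGen Glue b c → EqvGen Glue a c :=
      fun h1 h2 => EqvGen.trans _ _ _ h1 h2
    rcases coord_cases hz'.1 hw'.1 h.1 with ⟨rfl, rfl⟩ | ⟨e, rfl, rfl⟩ | ⟨e, rfl, rfl⟩ <;>
    rcases coord_cases hz'.2 hw'.2 h.2 with ⟨rfl, rfl⟩ | ⟨e', rfl, rfl⟩ | ⟨e', rfl, rfl⟩
    · exact EqvGen.refl _
    · fin_cases i <;> fin_cases j <;> fin_cases l <;> simp at e' hm hn
      · exact hs (.g1 ⟨x, hz'.1⟩)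
      · exact hs (.g2 ⟨x, hz'.1⟩)
      · exact hs' (.g6 ⟨x, hz'.1⟩)
      · exact hs' (.g5 ⟨x, hz'.1⟩)
    · fin_cases i <;> fin_cases j <;> fin_cases l <;> simp at e' hm hn
      · exact hs' (.g1 ⟨x, hz'.1⟩)
      · exact hs' (.g2 ⟨x, hz'.1⟩)
      · exact hs (.g6 ⟨x, hz'.1⟩)
      · exact hs (.g5 ⟨x, hz'.1⟩)
    · fin_cases i <;> fin_cases j <;> fin_cases k <;> simp at e hm hn
      · exact hs' (.g8 ⟨y, hz'.2⟩)
      · exact hs (.g3 ⟨y, hz'.2⟩)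
      · exact hs' (.g7 ⟨y, hz'.2⟩)
      · exact hs (.g4 ⟨y, hz'.2⟩)
    · fin_cases i <;> fin_cases j <;> fin_cases k <;> fin_cases l <;> simp at e e' hm hn
      · exact ht (hs (.g2 1)) (hs (.g3 0))
      · exact ht (hs' (.g7 1)) (hs' (.g6 0))
    · fin_cases i <;> fin_cases j <;> fin_cases k <;> fin_cases l <;> simp at e e' hm hn
      · exact ht (hs' (.g1 1)) (hs' (.g8 1))
      · exact ht (hs (.g4 0)) (hs (.g5 0))
    · fin_cases i <;> fin_cases j <;> fin_cases k <;> simp at e hm hn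
      · exact hs (.g8 ⟨y, hz'.2⟩)
      · exact hs' (.g3 ⟨y, hz'.2⟩)
      · exact hs (.g7 ⟨y, hz'.2⟩)
      · exact hs' (.g4 ⟨y, hz'.2⟩)
    · fin_cases i <;> fin_cases j <;> fin_cases k <;> fin_cases l <;> simp at e e' hm hn
      · exact ht (hs (.g8 1)) (hs (.g1 1))
      · exact ht (hs' (.g5 0)) (hs' (.g4 0))
    · fin_cases i <;> fin_cases j <;> fin_cases k <;> fin_cases l <;> simp at e e' hm hn
      · exact ht (hs' (.g3 0)) (hs' (.g2 1))
      · exact ht (hs (.g6 0)) (hs (.g7 1))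

/-! ## Square sets and the functor `M ⊗ -` -/

/-- A square set: a set `X` with an injective map `S_X : M₀ → X`. -/
structure SquaSet where
  carrier : Type
  S : M0 → carrier
  S_injective : Function.Injective S

namespace SquaSet

/-- Morphisms of square sets: maps preserving the designated boundary. -/
@[ext]
structure Hom (X Y : SquaSet) where
  toFun : X.carrier → Y.carrier
  map_S : ∀ z, toFun (X.S z) = Y.S z

instance : Category SquaSet where
  Hom := Hom
  id X := ⟨fun x => x, fun _ => rfl⟩
  comp f g := ⟨fun x => g.toFun (f.toFun x), fun z => by rw [f.map_S, g.map_S]⟩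

@[ext]
theorem hom_ext {X Y : SquaSet} {f g : X ⟶ Y} (h : ∀ x, f.toFun x = g.toFun x) : f = g :=
  Hom.ext (funext h)

/-- The relation `(m, S_X z) ≈ (n, S_X w)` for `(m, z)`, `(n, w)` in the gluing relation. -/
def GlueRel (X : SquaSet) (p q : Idx × X.carrier) : Prop :=
  ∃ m z n w, Glue (m, z) (n, w) ∧ p = (m, X.S z) ∧ q = (n, X.S w)

/-- The equivalence relation `∼` on `M × X` generated by `≈`. -/
def glueSetoid (X : SquaSet) : Setoid (Idx × X.carrier) := Relation.EqvGen.setoid X.GlueRel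

/-- The underlying set `M ⊗ X = (M × X)/∼`. -/
def Tensor (X : SquaSet) : Type := Quotient X.glueSetoid

/-- The class `m ⊗ x`. -/
def tmk (X : SquaSet) (m : Idx) (x : X.carrier) : X.Tensor := Quotient.mk X.glueSetoid (m, x)

theorem glueSetoid_iff (X : SquaSet) {p q : Idx × X.carrier} :
    X.glueSetoid.r p q ↔
      p = q ∨ ∃ z w, p.2 = X.S z ∧ q.2 = X.S w ∧ contract p.1 z = contract q.1 w := by
  constructor
  · intro h
    replace h : Relation.EqvGen X.GlueRel p q := h
    induction h with
    | rel p q h =>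
      obtain ⟨m, z, n, w, h, rfl, rfl⟩ := h
      exact Or.inr ⟨z, w, rfl, rfl, h.contract_eq⟩
    | refl p => exact Or.inl rfl
    | symm p q _ ih =>
      rcases ih with rfl | ⟨z, w, h1, h2, h3⟩
      · exact Or.inl rfl
      · exact Or.inr ⟨w, z, h2, h1, h3.symm⟩
    | trans p q r _ _ ih ih' =>
      rcases ih with rfl | ⟨z, w, h1, h2, h3⟩
      · exact ih'
      · rcases ih' with rfl | ⟨z', w', h1', h2', h3'⟩
        · exact Or.inr ⟨z, w, h1, h2, h3⟩
        · obtain rfl : w = z' := X.S_injective (h2.symm.trans h1')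
          exact Or.inr ⟨z, w', h1, h2', h3.trans h3'⟩
  · rintro (rfl | ⟨z, w, h1, h2, h3⟩)
    · exact Relation.EqvGen.refl _
    · obtain ⟨m, x⟩ := p
      obtain ⟨n, y⟩ := q
      dsimp only at h1 h2 h3
      subst h1 h2
      have h4 : Relation.EqvGen Glue (m, z) (n, w) := eqvGen_glue_iff.2 h3
      have key : ∀ a b, Relation.EqvGen Glue a b →
          Relation.EqvGen X.GlueRel (a.1, X.S a.2) (b.1, X.S b.2) := by
        intro a b hab
        induction hab with
        | rel a b h => exact .rel _ _ ⟨a.1, a.2, b.1, b.2, h, rfl, rfl⟩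
        | refl a => exact .refl _
        | symm _ _ _ ih => exact .symm _ _ ih
        | trans _ _ _ _ _ ih ih' => exact .trans _ _ _ ih ih'
      exact key _ _ h4

theorem tmk_eq_iff (X : SquaSet) {m n : Idx} {x y : X.carrier} :
    X.tmk m x = X.tmk n y ↔
      (m = n ∧ x = y) ∨ ∃ z w, x = X.S z ∧ y = X.S w ∧ contract m z = contract n w := by
  refine (Quotient.eq (r := X.glueSetoid)).trans (X.glueSetoid_iff.trans ?_)
  simp

end SquaSet

/-- The column (row) `0`, `1` or `2` of the `3 × 3` grid which contains the coordinate `x`. -/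
def third (x : ℝ) : Fin 3 := if x ≤ 1 / 3 then 0 else if x ≤ 2 / 3 then 1 else 2

theorem third_zero : third 0 = 0 := by simp [third]

theorem third_one : third 1 = 2 := by norm_num [third]

theorem three_mul_sub_third {x : ℝ} (hx : x ∈ Set.Icc (0 : ℝ) 1) :
    3 * x - ((third x : ℕ) : ℝ) ∈ Set.Icc (0 : ℝ) 1 := by
  obtain ⟨h0, h1⟩ := hx
  unfold third
  split_ifs <;> norm_num <;> constructor <;> linarith

/-- An index `m` of a small square having the boundary point `z` on its outer side. -/
def idxOf (z : M0) : Idx :=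
  ⟨(third z.1.1, third z.1.2), by
    obtain ⟨⟨x, y⟩, (⟨h | h, -⟩ | ⟨-, h | h⟩)⟩ := z <;> simp only at h <;> subst h <;>
      simp [third_zero, third_one]⟩

/-- The position of the boundary point `z` in the small square with index `idxOf z`. -/
def localOf (z : M0) : M0 :=
  ⟨(3 * z.1.1 - ((third z.1.1 : ℕ) : ℝ), 3 * z.1.2 - ((third z.1.2 : ℕ) : ℝ)), by
    obtain ⟨⟨x, y⟩, (⟨h | h, h'⟩ | ⟨h', h | h⟩)⟩ := z <;> simp only at h h' <;> subst h
    · exact Or.inl ⟨Or.inl (by simp [third_zero]), three_mul_sub_third h'⟩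
    · exact Or.inl ⟨Or.inr (by norm_num [third_one]), three_mul_sub_third h'⟩
    · exact Or.inr ⟨three_mul_sub_third h', Or.inl (by simp [third_zero])⟩
    · exact Or.inr ⟨three_mul_sub_third h', Or.inr (by norm_num [third_one])⟩⟩

theorem contract_localOf (z : M0) : contract (idxOf z) (localOf z) = z := by
  simp only [contract, idxOf, localOf]
  ext <;> simp only <;> ring

namespace SquaSet

/-- The map `S_{M ⊗ X}`: each side of `M ⊗ X` consists of three copies of the corresponding side of
`X`; for example `(r, 0) ↦ (1, 0) ⊗ S_X (3r - 1, 0)` for `1/3 ≤ r ≤ 2/3`. -/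
def tensorS (X : SquaSet) (z : M0) : X.Tensor := X.tmk (idxOf z) (X.S (localOf z))

/-- The map `S_{M ⊗ X}` does not depend on the choices made at the common end points of the
thirds of the sides: it is characterized by `S_{M ⊗ X} (σ_m w) = m ⊗ S_X w`. -/
theorem tensorS_eq (X : SquaSet) {z w : M0} {m : Idx} (h : contract m w = z) :
    X.tensorS z = X.tmk m (X.S w) :=
  X.tmk_eq_iff.2 (Or.inr ⟨_, _, rfl, rfl, (contract_localOf z).trans h.symm⟩)

theorem tensorS_injective (X : SquaSet) : Function.Injective X.tensorS := by
  intro z w h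
  have key : contract (idxOf z) (localOf z) = contract (idxOf w) (localOf w) := by
    rcases X.tmk_eq_iff.1 h with ⟨h1, h2⟩ | ⟨a, b, h1, h2, h3⟩
    · rw [h1, X.S_injective h2]
    · rwa [X.S_injective h1, X.S_injective h2]
  rw [contract_localOf, contract_localOf] at key
  exact Subtype.ext key

/-- The square set `M ⊗ X`. -/
def tensorObj (X : SquaSet) : SquaSet := ⟨X.Tensor, X.tensorS, X.tensorS_injective⟩

/-- The map `M ⊗ f : m ⊗ x ↦ m ⊗ f(x)`. -/
def tensorMap {X Y : SquaSet} (f : X ⟶ Y) : X.tensorObj ⟶ Y.tensorObj where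
  toFun := Quotient.lift (fun p : Idx × X.carrier => Y.tmk p.1 (f.toFun p.2)) (by
    rintro ⟨m, x⟩ ⟨n, y⟩ h
    rcases X.glueSetoid_iff.1 h with h | ⟨z, w, h1, h2, h3⟩
    · rw [h]
    · refine Y.tmk_eq_iff.2 (Or.inr ⟨z, w, ?_, ?_, h3⟩)
      · simp only at h1 ⊢
        rw [h1, f.map_S]
      · simp only at h2 ⊢
        rw [h2, f.map_S])
  map_S z := by
    change Y.tmk _ (f.toFun (X.S _)) = Y.tmk _ (Y.S _)
    rw [f.map_S]

/-- The endofunctor `M ⊗ -` on square sets. -/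
def tensor : SquaSet ⥤ SquaSet where
  obj := tensorObj
  map := tensorMap
  map_id X := by
    ext x
    induction x using Quotient.inductionOn with | h p => rfl
  map_comp f g := by
    ext x
    induction x using Quotient.inductionOn with | h p => rfl

end SquaSet

/-! ## Square metric spaces and the functor `M ⊗ -` on them -/

/-- A square metric space: a square set which is a metric space bounded by `2`, such that along each
side distances coincide with distances on the unit interval (`sq1`), and distances of boundary
points are bounded below by the taxicab distance (`sq2`). -/
structure SquaMS extends SquaSet where
  [metric : MetricSpace carrier]
  dist_le_two : ∀ x y : carrier, dist x y ≤ 2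
  sq1_left : ∀ r s : unitInterval, dist (S (left r)) (S (left s)) = |(s : ℝ) - r|
  sq1_right : ∀ r s : unitInterval, dist (S (right r)) (S (right s)) = |(s : ℝ) - r|
  sq1_bottom : ∀ r s : unitInterval, dist (S (bottom r)) (S (bottom s)) = |(s : ℝ) - r|
  sq1_top : ∀ r s : unitInterval, dist (S (top r)) (S (top s)) = |(s : ℝ) - r|
  sq2 : ∀ z w : M0, taxi z w ≤ dist (S z) (S w)

attribute [instance] SquaMS.metric

namespace SquaMS

/-- Morphisms of square metric spaces: short maps preserving the designated boundary. -/
structure Hom (X Y : SquaMS) extends SquaSet.Hom X.toSquaSet Y.toSquaSet where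
  short : ∀ x y, dist (toFun x) (toFun y) ≤ dist x y

instance : Category SquaMS where
  Hom := Hom
  id X := ⟨⟨fun x => x, fun _ => rfl⟩, fun _ _ => le_rfl⟩
  comp f g := ⟨⟨fun x => g.toFun (f.toFun x), fun z => by rw [f.map_S, g.map_S]⟩,
    fun x y => (g.short _ _).trans (f.short _ _)⟩

@[ext]
theorem hom_ext {X Y : SquaMS} {f g : X ⟶ Y} (h : ∀ x, f.toFun x = g.toFun x) : f = g := by
  obtain ⟨⟨f, _⟩, _⟩ := f
  obtain ⟨⟨g, _⟩, _⟩ := g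
  obtain rfl : f = g := funext h
  rfl

/-- The functor forgetting the metric. -/
def forgetMetric : SquaMS ⥤ SquaSet where
  obj X := X.toSquaSet
  map f := f.toHom

open Classical in
/-- The contribution to the score of a path of two consecutive entries `p`, `q` of `M × X`: it is
`0` if `p ∼ q`; otherwise it is their distance in `M × X`, which is `d_X / 3` inside one copy of `X`
and `2` between different copies. -/
def stepScore (X : SquaMS) (p q : Idx × X.carrier) : ℝ≥0 :=
  if X.glueSetoid.r p q then 0 else if p.1 = q.1 then nndist p.2 q.2 / 3 else 2

theorem stepScore_self (X : SquaMS) (p : Idx × X.carrier) : X.stepScore p p = 0 :=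
  if_pos (X.glueSetoid.refl p)

theorem stepScore_comm (X : SquaMS) (p q : Idx × X.carrier) :
    X.stepScore p q = X.stepScore q p := by
  have h : X.glueSetoid.r p q ↔ X.glueSetoid.r q p := ⟨X.glueSetoid.symm, X.glueSetoid.symm⟩
  unfold stepScore
  rw [nndist_comm p.2 q.2]
  by_cases h' : X.glueSetoid.r p q
  · rw [if_pos h', if_pos (h.1 h')]
  · rw [if_neg h', if_neg (fun e => h' (h.2 e))]
    simp only [eq_comm]

/-- The score of the path `p, l₁, …, lₖ, q` in `M × X`. -/
def score (X : SquaMS) (p : Idx × X.carrier) (l : List (Idx × X.carrier)) (q : Idx × X.carrier) :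
    ℝ≥0 :=
  (List.zipWith X.stepScore (p :: l) (l ++ [q])).sum

/-- The infimum of the scores of all finite paths in `M × X` from `p` to `q`. -/
def pathDist (X : SquaMS) (p q : Idx × X.carrier) : ℝ :=
  ((⨅ l : List (Idx × X.carrier), X.score p l q : ℝ≥0) : ℝ)

/-- The path distance as a pseudometric. -/
abbrev pathMetric (X : SquaMS) : PseudoMetricSpace (Idx × X.carrier) :=
  PseudoMetricSpace.ofPreNNDist X.stepScore X.stepScore_self X.stepScore_comm

theorem pathDist_self (X : SquaMS) (p : Idx × X.carrier) : X.pathDist p p = 0 :=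
  X.pathMetric.dist_self p

theorem pathDist_comm (X : SquaMS) (p q : Idx × X.carrier) : X.pathDist p q = X.pathDist q p :=
  X.pathMetric.dist_comm p q

theorem pathDist_triangle (X : SquaMS) (p q r : Idx × X.carrier) :
    X.pathDist p r ≤ X.pathDist p q + X.pathDist q r :=
  X.pathMetric.dist_triangle p q r

theorem pathDist_le_step (X : SquaMS) (p q : Idx × X.carrier) :
    X.pathDist p q ≤ X.stepScore p q :=
  PseudoMetricSpace.dist_ofPreNNDist_le X.stepScore X.stepScore_self X.stepScore_comm p q

theorem pathDist_nonneg (X : SquaMS) (p q : Idx × X.carrier) : 0 ≤ X.pathDist p q :=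
  NNReal.coe_nonneg _

theorem pathDist_eq_zero (X : SquaMS) {p q : Idx × X.carrier} (h : X.glueSetoid.r p q) :
    X.pathDist p q = 0 := by
  refine le_antisymm ((X.pathDist_le_step p q).trans ?_) (X.pathDist_nonneg p q)
  simp [stepScore, h]

theorem pathDist_congr (X : SquaMS) {p p' q q' : Idx × X.carrier} (hp : X.glueSetoid.r p p')
    (hq : X.glueSetoid.r q q') : X.pathDist p q = X.pathDist p' q' := by
  have h1 := X.pathDist_eq_zero hp
  have h2 := X.pathDist_eq_zero hq
  have h1' := X.pathDist_eq_zero (X.glueSetoid.symm hp)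
  have h2' := X.pathDist_eq_zero (X.glueSetoid.symm hq)
  linarith [X.pathDist_triangle p p' q, X.pathDist_triangle p' q' q,
    X.pathDist_triangle p' p q', X.pathDist_triangle p q q']

theorem pathDist_le_two (X : SquaMS) (p q : Idx × X.carrier) : X.pathDist p q ≤ 2 := by
  refine (X.pathDist_le_step p q).trans ?_
  unfold stepScore
  have := X.dist_le_two p.2 q.2
  split_ifs <;> push_cast <;> linarith

theorem pathDist_same_le (X : SquaMS) (m : Idx) (x y : X.carrier) :
    X.pathDist (m, x) (m, y) ≤ dist x y / 3 := by
  refine (X.pathDist_le_step _ _).trans ?_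
  unfold stepScore
  have : 0 ≤ dist x y := dist_nonneg
  split_ifs with h1 h2
  · push_cast; linarith
  · simp
  · exact absurd rfl h2

/-- A map on `M ⊗ X` which contracts distances in each copy by `3` is short. -/
theorem le_pathDist (X : SquaMS) {Z : Type} [PseudoMetricSpace Z] (f : X.Tensor → Z)
    (hsame : ∀ m x y, dist (f (X.tmk m x)) (f (X.tmk m y)) ≤ dist x y / 3)
    (htwo : ∀ a b, dist (f a) (f b) ≤ 2) (p q : Idx × X.carrier) :
    dist (f (X.tmk p.1 p.2)) (f (X.tmk q.1 q.2)) ≤ X.pathDist p q := by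
  have hstep : ∀ p q : Idx × X.carrier,
      dist (f (X.tmk p.1 p.2)) (f (X.tmk q.1 q.2)) ≤ X.stepScore p q := by
    rintro ⟨m, x⟩ ⟨n, y⟩
    unfold stepScore
    split_ifs with h1 h2
    · have : X.tmk m x = X.tmk n y := Quotient.sound h1
      simp [this]
    · simp only at h2
      subst h2
      simpa using hsame m x y
    · exact htwo _ _
  rw [pathDist, NNReal.coe_iInf]
  refine le_ciInf fun l => ?_
  induction l generalizing p with
  | nil => simpa [score] using hstep p q
  | cons r l ih =>
    have h1 := ih r
    have h2 := hstep p r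
    have h3 : X.score p (r :: l) q = X.stepScore p r + X.score r l q := by
      simp [score]
    rw [h3, NNReal.coe_add]
    exact (dist_triangle _ _ _).trans (add_le_add h2 h1)

theorem taxi_contract (m : Idx) (p q : ℝ × ℝ) :
    taxi (contract m p) (contract m q) = taxi p q / 3 := by
  have h : ∀ a b c : ℝ, |a / 3 + b / 3 - (a / 3 + c / 3)| = |b - c| / 3 := by
    intro a b c
    rw [show a / 3 + b / 3 - (a / 3 + c / 3) = (b - c) / 3 by ring, abs_div]
    norm_num
  simp only [taxi, contract, h]
  ring

theorem taxi_comm (p q : ℝ × ℝ) : taxi p q = taxi q p := by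
  simp only [taxi, abs_sub_comm]

theorem taxi_triangle (p q r : ℝ × ℝ) : taxi p r ≤ taxi p q + taxi q r := by
  simp only [taxi]
  linarith [abs_sub_le p.1 q.1 r.1, abs_sub_le p.2 q.2 r.2]

theorem taxi_nonneg (p q : ℝ × ℝ) : 0 ≤ taxi p q := by
  unfold taxi
  positivity

theorem taxi_le_two {p q : ℝ × ℝ} (hp : p ∈ unitSquare) (hq : q ∈ unitSquare) : taxi p q ≤ 2 := by
  obtain ⟨⟨_, _⟩, _, _⟩ := hp
  obtain ⟨⟨_, _⟩, _, _⟩ := hq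
  unfold taxi
  have h1 : |p.1 - q.1| ≤ 1 := abs_le.2 ⟨by linarith, by linarith⟩
  have h2 : |p.2 - q.2| ≤ 1 := abs_le.2 ⟨by linarith, by linarith⟩
  linarith

theorem eq_of_taxi_eq_zero {p q : ℝ × ℝ} (h : taxi p q = 0) : p = q := by
  unfold taxi at h
  have h1 : |p.1 - q.1| = 0 := by linarith [abs_nonneg (p.1 - q.1), abs_nonneg (p.2 - q.2)]
  have h2 : |p.2 - q.2| = 0 := by linarith [abs_nonneg (p.1 - q.1), abs_nonneg (p.2 - q.2)]
  exact Prod.ext (sub_eq_zero.1 (abs_eq_zero.1 h1)) (sub_eq_zero.1 (abs_eq_zero.1 h2))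

/-- Every boundary point lies on one of the four sides. -/
theorem side_cases (z : M0) :
    (∃ r, z = left r) ∨ (∃ r, z = right r) ∨ (∃ r, z = bottom r) ∨ (∃ r, z = top r) := by
  obtain ⟨⟨x, y⟩, (⟨h | h, h'⟩ | ⟨h', h | h⟩)⟩ := z <;> simp only at h h' <;> subst h
  · exact Or.inl ⟨⟨y, h'⟩, rfl⟩
  · exact Or.inr (Or.inl ⟨⟨y, h'⟩, rfl⟩)
  · exact Or.inr (Or.inr (Or.inl ⟨⟨x, h'⟩, rfl⟩))
  · exact Or.inr (Or.inr (Or.inr ⟨⟨x, h'⟩, rfl⟩))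

theorem dist_S_le (X : SquaMS) (z w : M0) : dist (X.S z) (X.S w) ≤ 2 * taxi z w := by
  have c1 : left 0 = bottom 0 := rfl
  have c2 : left 1 = top 0 := rfl
  have c3 : right 0 = bottom 1 := rfl
  have c4 : right 1 = top 1 := rfl
  have htwo := X.dist_le_two
  rcases side_cases z with ⟨r, rfl⟩ | ⟨r, rfl⟩ | ⟨r, rfl⟩ | ⟨r, rfl⟩ <;>
  rcases side_cases w with ⟨s, rfl⟩ | ⟨s, rfl⟩ | ⟨s, rfl⟩ | ⟨s, rfl⟩
  · rw [X.sq1_left]; simp [taxi, left, abs_sub_comm (s : ℝ)]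
    linarith [abs_nonneg ((r : ℝ) - s)]
  · refine (htwo _ _).trans ?_; simp [taxi, left, right]
  · have h := dist_triangle (X.S (left r)) (X.S (left 0)) (X.S (bottom s))
    rw [X.sq1_left, c1, X.sq1_bottom] at h
    refine h.trans ?_
    have := r.2.1; have := s.2.1
    simp [taxi, left, bottom]
    rw [abs_of_nonneg, abs_of_nonneg] <;> linarith
  · have h := dist_triangle (X.S (left r)) (X.S (left 1)) (X.S (top s))
    rw [X.sq1_left, c2, X.sq1_top] at h
    refine h.trans ?_
    have := r.2.1; have := s.2.1
    simp [taxi, left, top, abs_sub_comm (r : ℝ)]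
    rw [abs_of_nonneg (a := (s : ℝ))] <;> linarith [abs_nonneg (1 - (r : ℝ))]
  · refine (htwo _ _).trans ?_; simp [taxi, left, right]
  · rw [X.sq1_right]; simp [taxi, right, abs_sub_comm (s : ℝ)]
    linarith [abs_nonneg ((r : ℝ) - s)]
  · have h := dist_triangle (X.S (right r)) (X.S (right 0)) (X.S (bottom s))
    rw [X.sq1_right, c3, X.sq1_bottom] at h
    refine h.trans ?_
    have := r.2.1; have := s.2.1
    simp [taxi, right, bottom, abs_sub_comm (s : ℝ)]
    rw [abs_of_nonneg (a := (r : ℝ))] <;> linarith [abs_nonneg (1 - (s : ℝ))]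
  · have h := dist_triangle (X.S (right r)) (X.S (right 1)) (X.S (top s))
    rw [X.sq1_right, c4, X.sq1_top] at h
    refine h.trans ?_
    simp [taxi, right, top, abs_sub_comm (s : ℝ), abs_sub_comm (r : ℝ)]
    linarith [abs_nonneg (1 - (s : ℝ)), abs_nonneg (1 - (r : ℝ))]
  · have h := dist_triangle (X.S (bottom r)) (X.S (bottom 0)) (X.S (left s))
    rw [X.sq1_bottom, ← c1, X.sq1_left] at h
    refine h.trans ?_
    have := r.2.1; have := s.2.1
    simp [taxi, left, bottom]
    rw [abs_of_nonneg, abs_of_nonneg] <;> linarith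
  · have h := dist_triangle (X.S (bottom r)) (X.S (bottom 1)) (X.S (right s))
    rw [X.sq1_bottom, ← c3, X.sq1_right] at h
    refine h.trans ?_
    have := r.2.1; have := s.2.1
    simp [taxi, right, bottom, abs_sub_comm (r : ℝ)]
    rw [abs_of_nonneg (a := (s : ℝ))] <;> linarith [abs_nonneg (1 - (r : ℝ))]
  · rw [X.sq1_bottom]; simp [taxi, bottom, abs_sub_comm (s : ℝ)]
    linarith [abs_nonneg ((r : ℝ) - s)]
  · refine (htwo _ _).trans ?_; simp [taxi, bottom, top]
  · have h := dist_triangle (X.S (top r)) (X.S (top 0)) (X.S (left s))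
    rw [X.sq1_top, ← c2, X.sq1_left] at h
    refine h.trans ?_
    have := r.2.1; have := s.2.1
    simp [taxi, left, top, abs_sub_comm (s : ℝ)]
    rw [abs_of_nonneg (a := (r : ℝ))] <;> linarith [abs_nonneg (1 - (s : ℝ))]
  · have h := dist_triangle (X.S (top r)) (X.S (top 1)) (X.S (right s))
    rw [X.sq1_top, ← c4, X.sq1_right] at h
    refine h.trans ?_
    simp [taxi, right, top, abs_sub_comm (s : ℝ), abs_sub_comm (r : ℝ)]
    linarith [abs_nonneg (1 - (s : ℝ)), abs_nonneg (1 - (r : ℝ))]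
  · refine (htwo _ _).trans ?_; simp [taxi, bottom, top]
  · rw [X.sq1_top]; simp [taxi, top, abs_sub_comm (s : ℝ)]
    linarith [abs_nonneg ((r : ℝ) - s)]

/-- A taxicab-short function on the unit square, transported along the boundary of one copy,
extends to this copy. -/
theorem exists_extension (X : SquaMS) {F : ℝ × ℝ → ℝ}
    (hF : ∀ p ∈ unitSquare, ∀ q ∈ unitSquare, |F p - F q| ≤ taxi p q)
    (hF2 : ∀ p ∈ unitSquare, F p ∈ Set.Icc (0 : ℝ) 2) (m : Idx) :
    ∃ g : X.carrier → ℝ, (∀ x y, |g x - g y| ≤ dist x y / 3) ∧ (∀ x, g x ∈ Set.Icc (0 : ℝ) 2) ∧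
      ∀ z : M0, g (X.S z) = F (contract m z) := by
  have : Nonempty M0 := ⟨left 0⟩
  have hmem : ∀ z : M0, contract m z ∈ unitSquare :=
    fun z => contract_mem m (boundary_subset z.2)
  have hinv : ∀ z, Function.invFun X.S (X.S z) = z := Function.leftInverse_invFun X.S_injective
  have hL : LipschitzOnWith (1 / 3 : ℝ≥0)
      (fun x : X.carrier => F (contract m (Function.invFun X.S x : M0))) (Set.range X.S) := by
    refine LipschitzOnWith.of_dist_le_mul ?_
    rintro _ ⟨z, rfl⟩ _ ⟨w, rfl⟩
    simp only [hinv]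
    rw [Real.dist_eq]
    refine (hF _ (hmem z) _ (hmem w)).trans ?_
    rw [taxi_contract]
    push_cast
    linarith [X.sq2 z w]
  obtain ⟨g, hg, hgeq⟩ := hL.extend_real
  refine ⟨fun x => max 0 (min (g x) 2), fun x y => ?_, fun x => ⟨le_max_left _ _, ?_⟩, fun z => ?_⟩
  · have h := ((hg.min_const 2).const_max 0).dist_le_mul x y
    rw [Real.dist_eq] at h
    push_cast at h
    linarith
  · exact max_le (by norm_num) (min_le_right _ _)
  · have h := hgeq ⟨z, rfl⟩
    simp only [hinv] at h
    have h2 := hF2 _ (hmem z)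
    simp only
    rw [← h, min_eq_left h2.2, max_eq_right h2.1]

/-- Lower bounds of the path distance: a short function on the unit square and a compatible function
on one copy of `X` combine to a short function on `M ⊗ X`. -/
theorem exists_short (X : SquaMS) {F : ℝ × ℝ → ℝ}
    (hF : ∀ p ∈ unitSquare, ∀ q ∈ unitSquare, |F p - F q| ≤ taxi p q)
    (hF2 : ∀ p ∈ unitSquare, F p ∈ Set.Icc (0 : ℝ) 2) (m₀ : Idx) {g : X.carrier → ℝ}
    (hg : ∀ x y, |g x - g y| ≤ dist x y / 3) (hg2 : ∀ x, g x ∈ Set.Icc (0 : ℝ) 2)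
    (hgF : ∀ z : M0, g (X.S z) = F (contract m₀ z)) :
    ∃ f : Idx → X.carrier → ℝ, (∀ m x n y, |f m x - f n y| ≤ X.pathDist (m, x) (n, y)) ∧
      (∀ m (z : M0), f m (X.S z) = F (contract m z)) ∧ ∀ x, f m₀ x = g x := by
  classical
  choose e he he2 heF using X.exists_extension hF hF2
  have key : ∃ f : Idx → X.carrier → ℝ, (∀ x, f m₀ x = g x) ∧
      (∀ m x y, |f m x - f m y| ≤ dist x y / 3) ∧ (∀ m x, f m x ∈ Set.Icc (0 : ℝ) 2) ∧
      ∀ m (z : M0), f m (X.S z) = F (contract m z) := by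
    refine ⟨fun m => if m = m₀ then g else e m, fun x => by simp, fun m x y => ?_, fun m x => ?_,
      fun m z => ?_⟩ <;> by_cases h : m = m₀ <;> simp only [h, if_true, if_false]
    · exact hg x y
    · exact he m x y
    · exact hg2 x
    · exact he2 m x
    · exact hgF z
    · exact heF m z
  obtain ⟨f, hf0, hf1, hf2, hf3⟩ := key
  refine ⟨f, fun m x n y => ?_, hf3, hf0⟩
  let f' : X.Tensor → ℝ := Quotient.lift (fun p : Idx × X.carrier => f p.1 p.2) (by
    intro p q h
    rcases X.glueSetoid_iff.1 h with h | ⟨z, w, h1, h2, h3⟩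
    · rw [h]
    · rw [h1, h2, hf3, hf3, h3])
  have h := X.le_pathDist f' (fun m x y => by rw [Real.dist_eq]; exact hf1 m x y)
    (fun a b => by
      induction a using Quotient.inductionOn with | h p => ?_
      induction b using Quotient.inductionOn with | h q => ?_
      rw [Real.dist_eq]
      have h1 := hf2 p.1 p.2
      have h2 := hf2 q.1 q.2
      change |f p.1 p.2 - f q.1 q.2| ≤ 2
      exact abs_le.2 ⟨by linarith [h1.1, h2.2], by linarith [h1.2, h2.1]⟩) (m, x) (n, y)
  rw [Real.dist_eq] at h
  exact h

theorem taxi_le_pathDist (X : SquaMS) (m n : Idx) (z w : M0) :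
    taxi (contract m z) (contract n w) ≤ X.pathDist (m, X.S z) (n, X.S w) := by
  have hw := contract_mem n (boundary_subset w.2)
  have hF : ∀ p ∈ unitSquare, ∀ q ∈ unitSquare,
      |taxi p (contract n w) - taxi q (contract n w)| ≤ taxi p q := by
    intro p _ q _
    rw [abs_le]
    constructor
    · linarith [taxi_triangle q p (contract n w), taxi_comm p q]
    · linarith [taxi_triangle p q (contract n w)]
  have hF2 : ∀ p ∈ unitSquare, taxi p (contract n w) ∈ Set.Icc (0 : ℝ) 2 :=
    fun p hp => ⟨taxi_nonneg _ _, taxi_le_two hp hw⟩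
  obtain ⟨g, hg, hg2, hgF⟩ := X.exists_extension hF hF2 m
  obtain ⟨f, hf, hfF, -⟩ := X.exists_short hF hF2 m hg hg2 hgF
  have h := hf m (X.S z) n (X.S w)
  rw [hfF, hfF] at h
  have h0 : taxi (contract n w) (contract n w) = 0 := by simp [taxi]
  rw [h0, sub_zero, abs_of_nonneg (taxi_nonneg _ _)] at h
  exact h

/-- Within one copy of `X`, the path distance is bounded below by a multiple of the distance. -/
theorem dist_le_pathDist (X : SquaMS) (m : Idx) (x y : X.carrier) :
    dist x y / 6 ≤ X.pathDist (m, x) (m, y) := by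
  have : Nonempty M0 := ⟨left 0⟩
  let G : ℝ × ℝ → ℝ := fun p => ⨅ z : M0, (dist x (X.S z) / 6 + taxi p (contract m z))
  have hnn : ∀ (p : ℝ × ℝ) (z : M0), 0 ≤ dist x (X.S z) / 6 + taxi p (contract m z) := fun p z =>
    add_nonneg (by have : 0 ≤ dist x (X.S z) := dist_nonneg
                   linarith) (taxi_nonneg _ _)
  have hbdd : ∀ p : ℝ × ℝ, BddBelow (Set.range fun z : M0 =>
      (dist x (X.S z) / 6 + taxi p (contract m z))) := by
    intro p
    refine ⟨0, ?_⟩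
    rintro _ ⟨z, rfl⟩
    exact hnn p z
  have hG : ∀ p q, G p ≤ G q + taxi p q := by
    intro p q
    rw [← sub_le_iff_le_add]
    refine le_ciInf fun z => ?_
    have h1 : G p ≤ _ := ciInf_le (hbdd p) z
    have h2 := taxi_triangle p q (contract m z)
    linarith
  have hG0 : ∀ p, 0 ≤ G p := fun p => le_ciInf fun z => hnn p z
  have hGS : ∀ z : M0, G (contract m z) = dist x (X.S z) / 6 := by
    intro z
    refine le_antisymm ?_ (le_ciInf fun w => ?_)
    · refine (ciInf_le (hbdd _) z).trans (le_of_eq ?_)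
      simp [taxi]
    · rw [taxi_contract]
      have h1 := dist_triangle x (X.S w) (X.S z)
      have h2 := X.dist_S_le w z
      rw [taxi_comm] at h2
      linarith
  have hgL : ∀ a b, |dist x a / 6 - dist x b / 6| ≤ dist a b / 3 := by
    intro a b
    have h1 := dist_triangle x a b
    have h2 := dist_triangle x b a
    rw [dist_comm b a] at h2
    have h3 : 0 ≤ dist a b := dist_nonneg
    rw [abs_le]
    constructor <;> linarith
  have hg2 : ∀ a, dist x a / 6 ∈ Set.Icc (0 : ℝ) 2 := by
    intro a
    have h1 : 0 ≤ dist x a := dist_nonneg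
    have h2 := X.dist_le_two x a
    constructor <;> linarith
  have hFL : ∀ p ∈ unitSquare, ∀ q ∈ unitSquare, |min (G p) 2 - min (G q) 2| ≤ taxi p q := by
    intro p _ q _
    have h1 := abs_min_sub_min_le_max (G p) 2 (G q) 2
    have h2 : |G p - G q| ≤ taxi p q := by
      rw [abs_le]
      constructor <;> linarith [hG p q, hG q p, taxi_comm p q]
    refine h1.trans (max_le h2 ?_)
    simpa using taxi_nonneg p q
  have hF2 : ∀ p ∈ unitSquare, min (G p) 2 ∈ Set.Icc (0 : ℝ) 2 :=
    fun p _ => ⟨le_min (hG0 p) (by norm_num), min_le_right _ _⟩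
  obtain ⟨f, hf, -, hf0⟩ := X.exists_short hFL hF2 m hgL hg2 (fun z => by
    rw [hGS, min_eq_left (hg2 _).2])
  have h := hf m x m y
  rw [hf0, hf0, dist_self, zero_div, zero_sub, abs_neg, abs_of_nonneg (hg2 y).1] at h
  exact h

theorem continuous_S (X : SquaMS) : Continuous X.S := by
  have : LipschitzWith 4 X.S := by
    refine LipschitzWith.of_dist_le_mul fun z w => (X.dist_S_le z w).trans ?_
    have h1 : |z.1.1 - w.1.1| ≤ dist z w := le_max_left _ _
    have h2 : |z.1.2 - w.1.2| ≤ dist z w := le_max_right _ _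
    push_cast
    simp only [taxi]
    linarith
  exact this.continuous

theorem isClosed_boundary : IsClosed boundary := by
  have h : boundary = ((({0, 1} : Set ℝ) ×ˢ Set.Icc (0 : ℝ) 1) ∪
      (Set.Icc (0 : ℝ) 1 ×ˢ ({0, 1} : Set ℝ))) := by
    ext p
    simp [boundary, Set.mem_prod]
  rw [h]
  have h01 : IsClosed ({0, 1} : Set ℝ) := (Set.toFinite _).isClosed
  exact (h01.prod isClosed_Icc).union (isClosed_Icc.prod h01)

theorem isCompact_unitSquare : IsCompact unitSquare := by
  have h : unitSquare = Set.Icc (0 : ℝ) 1 ×ˢ Set.Icc (0 : ℝ) 1 := rfl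
  rw [h]
  exact isCompact_Icc.prod isCompact_Icc

theorem isClosed_range_S (X : SquaMS) : IsClosed (Set.range X.S) := by
  have : CompactSpace M0 :=
    isCompact_iff_compactSpace.1 (isCompact_unitSquare.of_isClosed_subset isClosed_boundary
      boundary_subset)
  exact (isCompact_range X.continuous_S).isClosed

theorem eq_of_pathDist_eq_zero_aux (X : SquaMS) {m n : Idx} {x y : X.carrier} (hmn : m ≠ n)
    (hx : x ∉ Set.range X.S) : X.pathDist (m, x) (n, y) ≠ 0 := by
  classical
  have hpos : 0 < Metric.infDist x (Set.range X.S) :=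
    (X.isClosed_range_S.notMem_iff_infDist_pos ⟨X.S (left 0), left 0, rfl⟩).1 hx
  set δ := Metric.infDist x (Set.range X.S) with hδ
  have hδ2 : δ ≤ 2 := (Metric.infDist_le_dist_of_mem (Set.mem_range_self (left 0))).trans (X.dist_le_two _ _)
  let b : X.carrier → ℝ := fun a => max 0 ((δ - dist x a) / 3)
  have hb0 : ∀ z, b (X.S z) = 0 := by
    intro z
    have : δ ≤ dist x (X.S z) := Metric.infDist_le_dist_of_mem ⟨z, rfl⟩
    exact max_eq_left (by linarith)
  have hbL : ∀ a c, |b a - b c| ≤ dist a c / 3 := by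
    intro a c
    refine (abs_max_sub_max_le_max _ _ _ _).trans ?_
    have h1 := dist_triangle x a c
    have h2 := dist_triangle x c a
    rw [dist_comm c a] at h2
    have h3 : 0 ≤ dist a c := dist_nonneg
    refine max_le (by simpa using div_nonneg h3 (by norm_num : (0 : ℝ) ≤ 3)) ?_
    rw [abs_le]
    constructor <;> linarith
  have hb2 : ∀ a, b a ∈ Set.Icc (0 : ℝ) 2 := fun a =>
    ⟨le_max_left _ _, max_le (by norm_num) (by have : 0 ≤ dist x a := dist_nonneg
                                               linarith)⟩
  let f : X.Tensor → ℝ := Quotient.lift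
    (fun p : Idx × X.carrier => if p.1 = m then b p.2 else 0) (by
    intro p q h
    rcases X.glueSetoid_iff.1 h with h | ⟨z, w, h1, h2, h3⟩
    · rw [h]
    · simp [h1, h2, hb0])
  have hf : ∀ k a, f (X.tmk k a) = if k = m then b a else 0 := fun k a => rfl
  have h := X.le_pathDist f (fun k a c => by
      rw [Real.dist_eq, hf, hf]
      split_ifs
      · exact hbL a c
      · simpa using div_nonneg (dist_nonneg : 0 ≤ dist a c) (by norm_num : (0 : ℝ) ≤ 3))
    (fun a c => by
      have hf2 : ∀ a, f a ∈ Set.Icc (0 : ℝ) 2 := by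
        intro a
        induction a using Quotient.inductionOn with | h p => ?_
        change (if p.1 = m then b p.2 else 0) ∈ Set.Icc (0 : ℝ) 2
        split_ifs
        · exact hb2 _
        · simp
      rw [Real.dist_eq, abs_le]
      constructor <;> linarith [(hf2 a).1, (hf2 a).2, (hf2 c).1, (hf2 c).2]) (m, x) (n, y)
  simp only [hf, if_true, hmn.symm, if_false, Real.dist_eq, sub_zero] at h
  have hbx : b x = δ / 3 := by
    simp only [b, dist_self, sub_zero]
    exact max_eq_right (by linarith)
  rw [hbx, abs_of_pos (by linarith)] at h
  linarith

theorem rel_of_pathDist_eq_zero (X : SquaMS) {p q : Idx × X.carrier} (h : X.pathDist p q = 0) :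
    X.glueSetoid.r p q := by
  obtain ⟨m, x⟩ := p
  obtain ⟨n, y⟩ := q
  by_cases hmn : m = n
  · subst hmn
    have h1 := X.dist_le_pathDist m x y
    rw [h] at h1
    have h2 : dist x y = 0 := le_antisymm (by linarith) dist_nonneg
    rw [dist_eq_zero.1 h2]
  · by_cases hx : x ∈ Set.range X.S
    · by_cases hy : y ∈ Set.range X.S
      · obtain ⟨z, rfl⟩ := hx
        obtain ⟨w, rfl⟩ := hy
        have h1 := X.taxi_le_pathDist m n z w
        rw [h] at h1
        exact X.glueSetoid_iff.2 (Or.inr ⟨z, w, rfl, rfl,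
          eq_of_taxi_eq_zero (le_antisymm h1 (taxi_nonneg _ _))⟩)
      · rw [X.pathDist_comm] at h
        exact absurd h (X.eq_of_pathDist_eq_zero_aux (Ne.symm hmn) hy)
    · exact absurd h (X.eq_of_pathDist_eq_zero_aux hmn hx)

/-- The metric of `M ⊗ X`: the distance of `m ⊗ x` and `n ⊗ y` is the infimum of the scores of all
finite paths in `M × X` from `(m, x)` to `(n, y)`. -/
instance tensorMetric (X : SquaMS) : MetricSpace X.tensorObj.carrier where
  dist := Quotient.lift₂ (fun p q => X.pathDist p q)
    (fun _ _ _ _ h1 h2 => X.pathDist_congr h1 h2)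
  dist_self a := by
    induction a using Quotient.inductionOn with | h p => exact X.pathDist_self p
  dist_comm a b := by
    induction a using Quotient.inductionOn with | h p => ?_
    induction b using Quotient.inductionOn with | h q => exact X.pathDist_comm p q
  dist_triangle a b c := by
    induction a using Quotient.inductionOn with | h p => ?_
    induction b using Quotient.inductionOn with | h q => ?_
    induction c using Quotient.inductionOn with | h r => exact X.pathDist_triangle p q r
  eq_of_dist_eq_zero {a b} h := by
    induction a using Quotient.inductionOn with | h p => ?_
    induction b using Quotient.inductionOn with | h q => ?_
    exact Quotient.sound (X.rel_of_pathDist_eq_zero h)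

theorem tensor_dist_eq (X : SquaMS) (m n : Idx) (x y : X.carrier) :
    dist (α := X.tensorObj.carrier) (X.tmk m x) (X.tmk n y) = X.pathDist (m, x) (n, y) := rfl

/-- A path in a metric space which is short on each third of the unit interval is short. -/
theorem dist_le_of_thirds {Y : Type} [PseudoMetricSpace Y] {φ : unitInterval → Y}
    (h : ∀ (k : Fin 3) (r s r' s' : unitInterval), (r : ℝ) = (k : ℕ) / 3 + (r' : ℝ) / 3 →
      (s : ℝ) = (k : ℕ) / 3 + (s' : ℝ) / 3 → dist (φ r) (φ s) ≤ |(s' : ℝ) - r'| / 3)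
    (r s : unitInterval) : dist (φ r) (φ s) ≤ |(s : ℝ) - r| := by
  have hk : ∀ (k : Fin 3) (r s : unitInterval), ((k : ℕ) : ℝ) / 3 ≤ r → r ≤ s →
      (s : ℝ) ≤ (k : ℕ) / 3 + 1 / 3 → dist (φ r) (φ s) ≤ (s : ℝ) - r := by
    intro k r s h1 h2 h3
    have h2' : (r : ℝ) ≤ s := h2
    have h4 := h k r s ⟨3 * r - (k : ℕ), by constructor <;> linarith⟩
      ⟨3 * s - (k : ℕ), by constructor <;> linarith⟩ (by simp only; ring) (by simp only; ring)
    simp only at h4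
    rw [abs_of_nonneg (by linarith)] at h4
    linarith
  have h0 : ∀ r s : unitInterval, (0 : ℝ) ≤ r → r ≤ s → (s : ℝ) ≤ 1 / 3 →
      dist (φ r) (φ s) ≤ (s : ℝ) - r :=
    fun r s a b c => hk 0 r s (by simpa using a) b (by simpa using c)
  have h1 : ∀ r s : unitInterval, (1 / 3 : ℝ) ≤ r → r ≤ s → (s : ℝ) ≤ 2 / 3 →
      dist (φ r) (φ s) ≤ (s : ℝ) - r :=
    fun r s a b c => hk 1 r s (by norm_num at a ⊢; exact a) b (by norm_num at c ⊢; exact c)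
  have h2 : ∀ r s : unitInterval, (2 / 3 : ℝ) ≤ r → r ≤ s → (s : ℝ) ≤ 1 →
      dist (φ r) (φ s) ≤ (s : ℝ) - r :=
    fun r s a b c => hk 2 r s (by norm_num at a ⊢; exact a) b (by norm_num at c ⊢; exact c)
  have main : ∀ r s : unitInterval, r ≤ s → dist (φ r) (φ s) ≤ (s : ℝ) - r := by
    let a : unitInterval := ⟨1 / 3, by constructor <;> norm_num⟩
    let b : unitInterval := ⟨2 / 3, by constructor <;> norm_num⟩
    have ha : (a : ℝ) = 1 / 3 := rfl
    have hb : (b : ℝ) = 2 / 3 := rfl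
    have step2 : ∀ r s : unitInterval, (1 : ℝ) / 3 ≤ r → r ≤ s →
        dist (φ r) (φ s) ≤ (s : ℝ) - r := by
      intro r s hr hrs
      have hrs' : (r : ℝ) ≤ s := hrs
      have := s.2.2
      rcases le_total (s : ℝ) (2 / 3) with hs | hs
      · exact h1 r s (by linarith) hrs (by linarith)
      · rcases le_total (r : ℝ) (2 / 3) with hr' | hr'
        · have e1 := h1 r b (by linarith) hr' hb.le
          have e2 := h2 b s hb.ge hs (by linarith)
          linarith [dist_triangle (φ r) (φ b) (φ s)]
        · exact h2 r s (by linarith) hrs (by linarith)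
    intro r s hrs
    have hrs' : (r : ℝ) ≤ s := hrs
    have := r.2.1
    rcases le_total (s : ℝ) (1 / 3) with hs | hs
    · exact h0 r s (by linarith) hrs (by linarith)
    · rcases le_total (r : ℝ) (1 / 3) with hr' | hr'
      · have e1 := h0 r a (by linarith) hr' ha.le
        have e2 := step2 a s ha.ge hs
        linarith [dist_triangle (φ r) (φ a) (φ s)]
      · exact step2 r s hr' hrs
  rcases le_total r s with hrs | hrs
  · have hrs' : (r : ℝ) ≤ s := hrs
    rw [abs_of_nonneg (by linarith)]
    exact main r s hrs
  · have hrs' : (s : ℝ) ≤ r := hrs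
    rw [dist_comm, abs_sub_comm, abs_of_nonneg (by linarith)]
    exact main s r hrs

theorem tensor_sq2 (X : SquaMS) (z w : M0) :
    taxi z w ≤ dist (X.tensorObj.S z) (X.tensorObj.S w) := by
  have h := X.taxi_le_pathDist (idxOf z) (idxOf w) (localOf z) (localOf w)
  rw [contract_localOf, contract_localOf] at h
  exact h

theorem tensor_sq1 (X : SquaMS) (side : unitInterval → M0) (cell : Fin 3 → Idx)
    (htaxi : ∀ r s, taxi (side r) (side s) = |(s : ℝ) - r|)
    (hX : ∀ r s, dist (X.S (side r)) (X.S (side s)) = |(s : ℝ) - r|)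
    (hcell : ∀ (k : Fin 3) (r r' : unitInterval), (r : ℝ) = (k : ℕ) / 3 + (r' : ℝ) / 3 →
      contract (cell k) (side r') = side r) (r s : unitInterval) :
    dist (X.tensorObj.S (side r)) (X.tensorObj.S (side s)) = |(s : ℝ) - r| := by
  refine le_antisymm ?_ ((htaxi r s).symm.le.trans (X.tensor_sq2 _ _))
  refine dist_le_of_thirds (φ := fun r => X.tensorObj.S (side r)) (fun k r s r' s' hr hs => ?_) r s
  have e1 : X.tensorObj.S (side r) = X.tmk (cell k) (X.S (side r')) :=
    X.tensorS_eq (hcell k r r' hr)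
  have e2 : X.tensorObj.S (side s) = X.tmk (cell k) (X.S (side s')) :=
    X.tensorS_eq (hcell k s s' hs)
  simp only [e1, e2]
  refine (X.pathDist_same_le _ _ _).trans (le_of_eq ?_)
  rw [hX]

/-- The square metric space `M ⊗ X`. -/
def tensorObj (X : SquaMS) : SquaMS where
  toSquaSet := X.toSquaSet.tensorObj
  metric := X.tensorMetric
  dist_le_two a b := by
    induction a using Quotient.inductionOn with | h p => ?_
    induction b using Quotient.inductionOn with | h q => exact X.pathDist_le_two p q
  sq1_left := X.tensor_sq1 left (fun k => ⟨(0, k), by simp⟩)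
    (fun r s => by simp [taxi, left, abs_sub_comm]) X.sq1_left
    (fun k r r' h => by simp [contract, left, h])
  sq1_right := X.tensor_sq1 right (fun k => ⟨(2, k), by simp⟩)
    (fun r s => by simp [taxi, right, abs_sub_comm]) X.sq1_right
    (fun k r r' h => by simp [contract, right, h]; norm_num)
  sq1_bottom := X.tensor_sq1 bottom (fun k => ⟨(k, 0), by simp⟩)
    (fun r s => by simp [taxi, bottom, abs_sub_comm]) X.sq1_bottom
    (fun k r r' h => by simp [contract, bottom, h])
  sq1_top := X.tensor_sq1 top (fun k => ⟨(k, 2), by simp⟩)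
    (fun r s => by simp [taxi, top, abs_sub_comm]) X.sq1_top
    (fun k r r' h => by simp [contract, top, h]; norm_num)
  sq2 := X.tensor_sq2

/-- A map on `M ⊗ X` which contracts distances in each copy by `3` is short. -/
theorem tensor_short (X : SquaMS) {Z : Type} [PseudoMetricSpace Z] (f : X.tensorObj.carrier → Z)
    (hsame : ∀ m x y, dist (f (X.tmk m x)) (f (X.tmk m y)) ≤ dist x y / 3)
    (htwo : ∀ a b, dist (f a) (f b) ≤ 2) (a b : X.tensorObj.carrier) :
    dist (f a) (f b) ≤ dist a b := by
  induction a using Quotient.inductionOn with | h p => ?_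
  induction b using Quotient.inductionOn with | h q => ?_
  exact X.le_pathDist f hsame htwo p q

/-- The map `M ⊗ f` on square metric spaces. -/
def tensorMap {X Y : SquaMS} (f : X ⟶ Y) : X.tensorObj ⟶ Y.tensorObj where
  toHom := SquaSet.tensorMap f.toHom
  short := X.tensor_short (Z := Y.tensorObj.carrier) _
    (fun m x y => (Y.pathDist_same_le m (f.toFun x) (f.toFun y)).trans
      (div_le_div_of_nonneg_right (f.short x y) (by norm_num)))
    (fun a b => Y.tensorObj.dist_le_two _ _)

/-- The endofunctor `M ⊗ -` on square metric spaces. -/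
def tensor : SquaMS ⥤ SquaMS where
  obj := tensorObj
  map := tensorMap
  map_id X := by
    ext x
    induction x using Quotient.inductionOn with | h p => rfl
  map_comp f g := by
    ext x
    induction x using Quotient.inductionOn with | h p => rfl

end SquaMS

/-! ## The Sierpinski carpet as a coalgebra on square sets -/

/-- The action `σ(A) = ⋃_m σ_m(A)` on sets. -/
def hutchinson (A : Set (ℝ × ℝ)) : Set (ℝ × ℝ) := ⋃ m, contract m '' A

theorem hutchinson_mono {A B : Set (ℝ × ℝ)} (h : A ⊆ B) : hutchinson A ⊆ hutchinson B :=
  Set.iUnion_mono fun _ => Set.image_mono h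

theorem continuous_contract (m : Idx) : Continuous (contract m) := by
  unfold contract
  fun_prop

theorem dist_contract (m : Idx) (p q : ℝ × ℝ) :
    dist (contract m p) (contract m q) ≤ dist p q / 3 := by
  have h : ∀ a b c : ℝ, dist (a / 3 + b / 3) (a / 3 + c / 3) = dist b c / 3 := by
    intro a b c
    rw [Real.dist_eq, Real.dist_eq, show a / 3 + b / 3 - (a / 3 + c / 3) = (b - c) / 3 by ring,
      abs_div]
    norm_num
  simp only [Prod.dist_eq, contract, h]
  exact max_le (div_le_div_of_nonneg_right (le_max_left _ _) (by norm_num))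
    (div_le_div_of_nonneg_right (le_max_right _ _) (by norm_num))

theorem subset_of_hutchinson {A K : Set (ℝ × ℝ)} (hA : A ⊆ unitSquare) (hAσ : A ⊆ hutchinson A)
    (hK : K ⊆ unitSquare) (hne : K.Nonempty) (hc : IsClosed K) (hKσ : hutchinson K ⊆ K) :
    A ⊆ K := by
  have key : ∀ n : ℕ, ∀ p ∈ A, ∃ q ∈ K, dist p q ≤ (1 / 3 : ℝ) ^ n := by
    intro n
    induction n with
    | zero =>
      intro p hp
      obtain ⟨q, hq⟩ := hne
      refine ⟨q, hq, ?_⟩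
      obtain ⟨⟨_, _⟩, _, _⟩ := hA hp
      obtain ⟨⟨_, _⟩, _, _⟩ := hK hq
      rw [pow_zero, Prod.dist_eq, Real.dist_eq, Real.dist_eq]
      exact max_le (abs_le.2 ⟨by linarith, by linarith⟩) (abs_le.2 ⟨by linarith, by linarith⟩)
    | succ n ih =>
      intro p hp
      obtain ⟨m, p', hp', rfl⟩ := Set.mem_iUnion.1 (hAσ hp)
      obtain ⟨q, hq, hd⟩ := ih p' hp'
      refine ⟨contract m q, hKσ (Set.mem_iUnion.2 ⟨m, q, hq, rfl⟩), ?_⟩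
      refine (dist_contract m p' q).trans ?_
      rw [pow_succ]
      linarith
  intro p hp
  rw [← hc.closure_eq, Metric.mem_closure_iff]
  intro ε hε
  obtain ⟨n, hn⟩ := exists_pow_lt_of_lt_one hε (by norm_num : (1 / 3 : ℝ) < 1)
  obtain ⟨q, hq, hd⟩ := key n p hp
  exact ⟨q, hq, hd.trans_lt hn⟩

theorem boundary_subset_hutchinson : boundary ⊆ hutchinson boundary := fun z hz =>
  Set.mem_iUnion.2 ⟨idxOf ⟨z, hz⟩, localOf ⟨z, hz⟩, (localOf ⟨z, hz⟩).2, contract_localOf ⟨z, hz⟩⟩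

/-- There is exactly one non-empty compact subset of the unit square which is fixed by `σ`. -/
theorem existsUnique_carpet :
    ∃! K : Set (ℝ × ℝ), K.Nonempty ∧ IsCompact K ∧ K ⊆ unitSquare ∧ hutchinson K = K := by
  let L : Set (ℝ × ℝ) := ⋃₀ {A | A ⊆ unitSquare ∧ A ⊆ hutchinson A}
  have hLU : L ⊆ unitSquare := Set.sUnion_subset fun A hA => hA.1
  have hLσ : L ⊆ hutchinson L := Set.sUnion_subset fun A hA =>
    hA.2.trans (hutchinson_mono (Set.subset_sUnion_of_mem hA))
  have hσU : ∀ A ⊆ unitSquare, hutchinson A ⊆ unitSquare := by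
    intro A hA
    refine Set.iUnion_subset fun m => ?_
    rintro _ ⟨p, hp, rfl⟩
    exact contract_mem m (hA hp)
  have hmax : ∀ A ⊆ unitSquare, A ⊆ hutchinson A → A ⊆ L := fun A h1 h2 =>
    Set.subset_sUnion_of_mem ⟨h1, h2⟩
  have hσL : hutchinson L ⊆ L := hmax _ (hσU L hLU) (hutchinson_mono hLσ)
  have hUc : IsClosed unitSquare := SquaMS.isCompact_unitSquare.isClosed
  have hclU : closure L ⊆ unitSquare := closure_minimal hLU hUc
  have hclc : IsCompact (closure L) :=
    SquaMS.isCompact_unitSquare.of_isClosed_subset isClosed_closure hclU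
  have hclσ : closure L ⊆ hutchinson (closure L) := by
    refine closure_minimal (hLσ.trans (hutchinson_mono subset_closure)) ?_
    exact (isCompact_iUnion fun m => hclc.image (continuous_contract m)).isClosed
  have hLcl : closure L = L := Set.Subset.antisymm (hmax _ hclU hclσ) subset_closure
  have hbL : boundary ⊆ L := hmax _ boundary_subset boundary_subset_hutchinson
  have hLc : IsCompact L := hLcl ▸ hclc
  have hLne : L.Nonempty := ⟨left 0, hbL (left 0).2⟩
  refine ⟨L, ⟨hLne, hLc, hLU, Set.Subset.antisymm hσL hLσ⟩, ?_⟩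
  rintro K ⟨hne, hK, hKU, hKσ⟩
  refine Set.Subset.antisymm (hmax _ hKU hKσ.ge) ?_
  exact subset_of_hutchinson hLU hLσ hKU hne hK.isClosed hKσ.le

/-- The Sierpinski carpet `𝕊`: the unique non-empty compact subset of the unit square which is fixed
by `σ`. -/
def carpet : Set (ℝ × ℝ) := Classical.choose existsUnique_carpet.exists

theorem carpet_spec :
    carpet.Nonempty ∧ IsCompact carpet ∧ carpet ⊆ unitSquare ∧ hutchinson carpet = carpet :=
  Classical.choose_spec existsUnique_carpet.exists

theorem boundary_subset_carpet : boundary ⊆ carpet :=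
  subset_of_hutchinson boundary_subset boundary_subset_hutchinson carpet_spec.2.2.1 carpet_spec.1
    carpet_spec.2.1.isClosed carpet_spec.2.2.2.le

theorem contract_mem_carpet (m : Idx) {p : ℝ × ℝ} (hp : p ∈ carpet) : contract m p ∈ carpet :=
  carpet_spec.2.2.2.le (Set.mem_iUnion.2 ⟨m, p, hp, rfl⟩)

/-- The carpet as a square set, with the inclusion of `M₀`. -/
def carpetObj : SquaSet where
  carrier := carpet
  S z := ⟨z, boundary_subset_carpet z.2⟩
  S_injective _ _ h := Subtype.ext (congrArg (fun a : carpet => a.1) h)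

/-- The map `τ : M ⊗ 𝕊 → 𝕊`, `m ⊗ s ↦ σ_m(s)`. -/
def tau : SquaSet.tensor.obj carpetObj ⟶ carpetObj where
  toFun := Quotient.lift
    (fun p : Idx × carpetObj.carrier => (⟨contract p.1 p.2.1, contract_mem_carpet p.1 p.2.2⟩ :
      carpetObj.carrier)) (by
    rintro ⟨m, x⟩ ⟨n, y⟩ h
    rcases carpetObj.glueSetoid_iff.1 h with h | ⟨z, w, h1, h2, h3⟩
    · rw [h]
    · simp only at h1 h2
      subst h1 h2
      exact Subtype.ext h3)
  map_S z := Subtype.ext (contract_localOf z)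

theorem tau_bijective : Function.Bijective tau.toFun := by
  constructor
  · intro a b h
    induction a using Quotient.inductionOn with | h p => ?_
    induction b using Quotient.inductionOn with | h q => ?_
    obtain ⟨⟨⟨i, j⟩, hm⟩, ⟨⟨x, y⟩, hp⟩⟩ := p
    obtain ⟨⟨⟨k, l⟩, hn⟩, ⟨⟨t, u⟩, hq⟩⟩ := q
    have h' : contract ⟨(i, j), hm⟩ (x, y) = contract ⟨(k, l), hn⟩ (t, u) :=
      congrArg Subtype.val h
    have hpU := carpet_spec.2.2.1 hp
    have hqU := carpet_spec.2.2.1 hq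
    have h'' := h'
    simp only [contract, Prod.mk.injEq] at h''
    refine (carpetObj.tmk_eq_iff (m := ⟨(i, j), hm⟩) (n := ⟨(k, l), hn⟩) (x := ⟨(x, y), hp⟩)
      (y := ⟨(t, u), hq⟩)).2 ?_
    have glue := fun (h1 : (x, y) ∈ boundary) (h2 : (t, u) ∈ boundary) =>
      (⟨⟨(x, y), h1⟩, ⟨(t, u), h2⟩, rfl, rfl, h'⟩ : ∃ z w : M0,
        (⟨(x, y), hp⟩ : carpet) = carpetObj.S z ∧ (⟨(t, u), hq⟩ : carpet) = carpetObj.S w ∧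
          contract ⟨(i, j), hm⟩ z = contract ⟨(k, l), hn⟩ w)
    rcases coord_cases hpU.1 hqU.1 h''.1 with ⟨rfl, rfl⟩ | ⟨-, rfl, rfl⟩ | ⟨-, rfl, rfl⟩
    · rcases coord_cases hpU.2 hqU.2 h''.2 with ⟨rfl, rfl⟩ | ⟨-, rfl, rfl⟩ | ⟨-, rfl, rfl⟩
      · exact Or.inl ⟨rfl, rfl⟩
      · exact Or.inr (glue (Or.inr ⟨hpU.1, Or.inr rfl⟩) (Or.inr ⟨hpU.1, Or.inl rfl⟩))
      · exact Or.inr (glue (Or.inr ⟨hpU.1, Or.inl rfl⟩) (Or.inr ⟨hpU.1, Or.inr rfl⟩))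
    · exact Or.inr (glue (Or.inl ⟨Or.inr rfl, hpU.2⟩) (Or.inl ⟨Or.inl rfl, hqU.2⟩))
    · exact Or.inr (glue (Or.inl ⟨Or.inl rfl, hpU.2⟩) (Or.inl ⟨Or.inr rfl, hqU.2⟩))
  · rintro ⟨p, hp⟩
    have hp' := hp
    rw [← carpet_spec.2.2.2] at hp'
    obtain ⟨m, q, hq, h⟩ := Set.mem_iUnion.1 hp'
    exact ⟨carpetObj.tmk m ⟨q, hq⟩, Subtype.ext h⟩

theorem SquaSet.isIso_of_bijective {X Y : SquaSet} (f : X ⟶ Y) (hf : Function.Bijective f.toFun) :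
    IsIso f := by
  let e := Equiv.ofBijective f.toFun hf
  refine ⟨⟨⟨e.symm, fun z => ?_⟩, ?_, ?_⟩⟩
  · rw [Equiv.symm_apply_eq]
    exact (f.map_S z).symm
  · ext x
    exact e.symm_apply_apply x
  · ext y
    exact e.apply_symm_apply y

instance isIso_tau : IsIso tau := SquaSet.isIso_of_bijective tau tau_bijective

/-- The coalgebra `(𝕊, τ⁻¹)` for `M ⊗ -` on square sets. -/
def carpetCoalgebra : Endofunctor.Coalgebra SquaSet.tensor where
  V := carpetObj
  str := inv tau

/-! ## The completion functor and the coalgebra `(Q, γ)` -/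

open UniformSpace

namespace SquaMS

/-- The Cauchy completion of a square metric space. -/
def completionObj (X : SquaMS) : SquaMS where
  carrier := Completion X.carrier
  S z := (X.S z : Completion X.carrier)
  S_injective z w h := X.S_injective (Completion.coe_injective _ h)
  dist_le_two x y := by
    induction x, y using Completion.induction_on₂ with
    | hp => exact isClosed_le continuous_dist continuous_const
    | ih x y => rw [Completion.dist_eq]; exact X.dist_le_two x y
  sq1_left r s := by rw [Completion.dist_eq]; exact X.sq1_left r s
  sq1_right r s := by rw [Completion.dist_eq]; exact X.sq1_right r s
  sq1_bottom r s := by rw [Completion.dist_eq]; exact X.sq1_bottom r s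
  sq1_top r s := by rw [Completion.dist_eq]; exact X.sq1_top r s
  sq2 z w := by rw [Completion.dist_eq]; exact X.sq2 z w

theorem Hom.lipschitz {X Y : SquaMS} (f : X ⟶ Y) : LipschitzWith 1 f.toFun :=
  LipschitzWith.of_dist_le_mul fun x y => by simpa using f.short x y

/-- The extension of a short map to the completions. -/
def completionMap {X Y : SquaMS} (f : X ⟶ Y) : X.completionObj ⟶ Y.completionObj where
  toFun := Completion.map f.toFun
  map_S z := by
    change Completion.map f.toFun (X.S z : Completion X.carrier) = (Y.S z : Completion Y.carrier)
    rw [Completion.map_coe (Hom.lipschitz f).uniformContinuous, f.map_S]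
  short x y := by
    have h := (Hom.lipschitz f).completion_map.dist_le_mul x y
    rw [NNReal.coe_one, one_mul] at h
    exact h

/-- The Cauchy completion `C` as an endofunctor on square metric spaces. -/
def completion : SquaMS ⥤ SquaMS where
  obj := completionObj
  map := completionMap
  map_id X := by
    ext x
    exact congrFun Completion.map_id x
  map_comp f g := by
    ext x
    exact (congrFun (Completion.map_comp (Hom.lipschitz g).uniformContinuous
      (Hom.lipschitz f).uniformContinuous) x).symm

/-- The map `x ↦ m ⊗ x`. -/
def incl (X : SquaMS) (m : Idx) (x : X.carrier) : X.tensorObj.carrier := X.tmk m x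

theorem dist_incl (X : SquaMS) (m : Idx) (x y : X.carrier) :
    dist (X.incl m x) (X.incl m y) = X.pathDist (m, x) (m, y) := rfl

theorem lipschitz_incl (X : SquaMS) (m : Idx) :
    LipschitzWith (1 / 3) (X.incl m) :=
  LipschitzWith.of_dist_le_mul fun x y => by
    refine (X.pathDist_same_le m x y).trans (le_of_eq ?_)
    push_cast
    ring

theorem antilipschitz_incl (X : SquaMS) (m : Idx) :
    AntilipschitzWith 6 (X.incl m) :=
  AntilipschitzWith.of_le_mul_dist fun x y => by
    have h := X.dist_le_pathDist m x y
    rw [dist_incl]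
    push_cast
    linarith

/-- The map `δ_X : M ⊗ C(X) → C(M ⊗ X)`, which sends `m ⊗ (x₀, x₁, …)` to the class of the Cauchy
sequence `(m ⊗ x₀, m ⊗ x₁, …)`. -/
def deltaFun (X : SquaMS) :
    X.completionObj.tensorObj.carrier → X.tensorObj.completionObj.carrier :=
  Quotient.lift (fun p : Idx × X.completionObj.carrier =>
    (Completion.map (X.incl p.1) p.2 :
      Completion X.tensorObj.carrier)) (by
    rintro ⟨m, x⟩ ⟨n, y⟩ h
    rcases X.completionObj.glueSetoid_iff.1 h with h | ⟨z, w, h1, h2, h3⟩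
    · rw [h]
    · simp only at h1 h2 h3
      subst h1 h2
      change Completion.map _ (X.S z : Completion X.carrier) =
        Completion.map _ (X.S w : Completion X.carrier)
      rw [Completion.map_coe (X.lipschitz_incl m).uniformContinuous,
        Completion.map_coe (X.lipschitz_incl n).uniformContinuous]
      exact congrArg _ (X.tmk_eq_iff.2 (Or.inr ⟨z, w, rfl, rfl, h3⟩)))

theorem deltaFun_coe (X : SquaMS) (m : Idx) (x : X.carrier) :
    X.deltaFun (X.completionObj.incl m (x : Completion X.carrier)) =
      (X.incl m x : Completion X.tensorObj.carrier) :=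
  Completion.map_coe (X.lipschitz_incl m).uniformContinuous x

theorem deltaFun_short (X : SquaMS) (a b : X.completionObj.tensorObj.carrier) :
    dist (X.deltaFun a) (X.deltaFun b) ≤ dist a b := by
  refine X.completionObj.tensor_short X.deltaFun (fun m x y => ?_)
    (fun a b => X.tensorObj.completionObj.dist_le_two _ _) a b
  have h := (X.lipschitz_incl m).completion_map.dist_le_mul x y
  have h3 : ((1 / 3 : ℝ≥0) : ℝ) = 1 / 3 := by push_cast; rfl
  rw [h3, one_div_mul_eq_div] at h
  exact h

/-- The unit `X → C(X)`. -/
def unit (X : SquaMS) : X ⟶ X.completionObj where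
  toFun x := (x : Completion X.carrier)
  map_S _ := rfl
  short x y := (Completion.dist_eq x y).le

theorem deltaFun_isometry (X : SquaMS) : Isometry X.deltaFun := by
  have hdense : DenseRange (fun a => (tensorMap X.unit).toFun a) := by
    intro b
    induction b using Quotient.inductionOn with | h p => ?_
    obtain ⟨m, x⟩ := p
    have h1 : x ∈ closure (Set.range ((↑) : X.carrier → Completion X.carrier)) :=
      Completion.denseRange_coe x
    have h2 := mem_closure_image (X.completionObj.lipschitz_incl m).continuous.continuousAt h1
    refine closure_mono ?_ h2
    rintro _ ⟨_, ⟨y, rfl⟩, rfl⟩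
    exact ⟨X.incl m y, rfl⟩
  have hcont : Continuous X.deltaFun :=
    (LipschitzWith.of_dist_le_mul (K := 1) fun a b => by
      simpa using X.deltaFun_short a b).continuous
  refine Isometry.of_dist_eq fun a b => le_antisymm (X.deltaFun_short a b) ?_
  refine hdense.induction_on₂ (p := fun a b => dist a b ≤ dist (X.deltaFun a) (X.deltaFun b))
    ?_ ?_ a b
  · exact isClosed_le continuous_dist
      ((hcont.comp continuous_fst).dist (hcont.comp continuous_snd))
  · intro a b
    have h : ∀ a, X.deltaFun ((tensorMap X.unit).toFun a) =
        (a : Completion X.tensorObj.carrier) := by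
      intro a
      induction a using Quotient.inductionOn with | h p => exact X.deltaFun_coe p.1 p.2
    rw [h, h]
    exact ((tensorMap X.unit).short a b).trans (Completion.dist_eq a b).ge

theorem deltaFun_surjective (X : SquaMS) : Function.Surjective X.deltaFun := by
  have hclosed : IsClosed (⋃ m : Idx, Set.range
      (Completion.map (X.incl m))) := by
    refine isClosed_iUnion_of_finite fun m => ?_
    have hanti : AntilipschitzWith 6
        (Completion.map (X.incl m)) := by
      refine AntilipschitzWith.of_le_mul_dist fun x y => ?_
      induction x, y using Completion.induction_on₂ with
      | hp =>
        exact isClosed_le continuous_dist (continuous_const.mul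
          ((Completion.continuous_map.comp continuous_fst).dist
            (Completion.continuous_map.comp continuous_snd)))
      | ih x y =>
        rw [Completion.map_coe (X.lipschitz_incl m).uniformContinuous,
          Completion.map_coe (X.lipschitz_incl m).uniformContinuous, Completion.dist_eq,
          Completion.dist_eq]
        exact (X.antilipschitz_incl m).le_mul_dist x y
    exact hanti.isClosed_range (Completion.uniformContinuous_map)
  intro b
  have hb : b ∈ ⋃ m : Idx, Set.range
      (Completion.map (X.incl m)) := by
    refine Completion.induction_on b hclosed fun a => ?_
    induction a using Quotient.inductionOn with | h p => ?_
    exact Set.mem_iUnion.2 ⟨p.1, (p.2 : Completion X.carrier),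
      Completion.map_coe (X.lipschitz_incl p.1).uniformContinuous p.2⟩
  obtain ⟨m, x, hx⟩ := Set.mem_iUnion.1 hb
  exact ⟨X.completionObj.incl m x, hx⟩

/-- The morphism `δ_X : M ⊗ C(X) → C(M ⊗ X)`. -/
def delta (X : SquaMS) :
    tensor.obj (completion.obj X) ⟶ completion.obj (tensor.obj X) where
  toFun := X.deltaFun
  map_S z := X.deltaFun_coe (idxOf z) (X.S (localOf z))
  short := X.deltaFun_short

instance isIso_delta (X : SquaMS) : IsIso X.delta := by
  let e := Equiv.ofBijective X.deltaFun ⟨X.deltaFun_isometry.injective, X.deltaFun_surjective⟩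
  refine ⟨⟨⟨⟨e.symm, fun z => ?_⟩, fun x y => ?_⟩, ?_, ?_⟩⟩
  · exact (Equiv.symm_apply_eq e).2 (X.delta.map_S z).symm
  · obtain ⟨a, rfl⟩ := e.surjective x
    obtain ⟨b, rfl⟩ := e.surjective y
    have h := (X.deltaFun_isometry.dist_eq a b).ge
    have ha := e.symm_apply_apply a
    have hb := e.symm_apply_apply b
    change dist (e.symm (e a)) (e.symm (e b)) ≤ dist (X.deltaFun a) (X.deltaFun b)
    rw [ha, hb]
    exact h
  · ext x
    exact e.symm_apply_apply x
  · ext y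
    exact e.apply_symm_apply y

/-- For an initial algebra `(G, η)` of `M ⊗ -` on square metric spaces, the coalgebra `(Q, γ)` on
square metric spaces: `Q = C(G)` and `γ : C(G) → C(M ⊗ G) ≅ M ⊗ C(G)` is `C(η⁻¹)`. -/
def completionCoalgebra {G : Endofunctor.Algebra tensor} (hG : Limits.IsInitial G) :
    Endofunctor.Coalgebra tensor where
  V := completion.obj G.a
  str := completion.map (Endofunctor.Algebra.Initial.strInv hG) ≫ inv G.a.delta

/-- Forgetting the metric turns coalgebras on square metric spaces into coalgebras on square
sets. -/
def forgetCoalgebra (A : Endofunctor.Coalgebra tensor) :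
    Endofunctor.Coalgebra SquaSet.tensor where
  V := forgetMetric.obj A.V
  str := forgetMetric.map A.str

end SquaMS

end

end SquareSets

namespace SquareSets

open CategoryTheory

noncomputable section

/-! Both finality statements are instances of Banach's fixed point argument. If the structure of a
coalgebra `B` has inverse `φ`, then the coalgebra morphisms `X ⟶ B` are exactly the fixed points of
`f ↦ X.str ≫ (M ⊗ f) ≫ φ`. Suppose `B` carries a complete bounded metric for which `φ` divides
distances by 3 inside each copy. The operator then divides uniform distances by 3, so it has exactly
one fixed point. No metric on `X` is involved. This is `nonempty_isTerminal_of_contracting`. It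
applies to the compact carpet with the metric of the plane, because the `σ_m` scale by 1/3. It also
applies to `Q = C(G)`, because `γ⁻¹` is short and `x ↦ m ⊗ x` scales distances by at most 1/3;
initiality of `G` serves only to make `η` invertible.

For the existence of `G`, the underlying set consists of the points obtained from `M₀` by finitely
many `σ_m`. Such a point is evaluated in an algebra by replaying its construction. The result does
not depend on the construction (`Eval.unique`): by injectivity of `τ`, two constructions of a point
can differ only through gluings on the boundary, which every algebra respects. This gives a unique
square set morphism `fold` compatible with the structure maps. The metric is the supremum, over all
algebras, of the distances between evaluated points. It is the smallest metric for which every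
`fold` is short, and it inherits contraction by 3 from the algebras. The carpet with the taxicab
metric is one of these algebras; it keeps distinct points apart and supplies the lower bounds that a
square metric space requires. -/

/-! ## Final coalgebras from contractions -/

section Terminal

variable {B : Endofunctor.Coalgebra SquaSet.tensor} {X : Endofunctor.Coalgebra SquaSet.tensor}
  (φ : SquaSet.tensor.obj B.V ⟶ B.V)

/-- Coalgebra morphisms into a coalgebra with structure `φ⁻¹` are the fixed points of this operator
on morphisms of square sets. -/
def unfoldStep (f : X.V ⟶ B.V) : X.V ⟶ B.V := X.str ≫ SquaSet.tensor.map f ≫ φ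

theorem unfoldStep_apply (f : X.V ⟶ B.V) {x : X.V.carrier} {m : Idx} {y : X.V.carrier}
    (h : X.str.toFun x = X.V.tmk m y) :
    (unfoldStep φ f).toFun x = φ.toFun (B.V.tmk m (f.toFun y)) := by
  change φ.toFun ((SquaSet.tensorMap f).toFun (X.str.toFun x)) = _
  rw [h]
  rfl

theorem exists_str_eq_tmk (X : Endofunctor.Coalgebra SquaSet.tensor) (x : X.V.carrier) :
    ∃ m y, X.str.toFun x = X.V.tmk m y := by
  obtain ⟨⟨m, y⟩, h⟩ := Quotient.exists_rep (X.str.toFun x)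
  exact ⟨m, y, h.symm⟩

open Classical in
/-- Some morphism of square sets. -/
def someHom (X Y : SquaSet) : X ⟶ Y where
  toFun x := if h : ∃ z, x = X.S z then Y.S h.choose else Y.S (left 0)
  map_S z := by
    have h : ∃ w, X.S z = X.S w := ⟨z, rfl⟩
    rw [dif_pos h, ← X.S_injective h.choose_spec]

variable [MetricSpace B.V.carrier]

/-- The representation `m ⊗ y` of the unfolded point depends neither on `f` nor on `g`. Both new
values therefore come from the same copy `m`, and contraction within single copies is enough. -/
theorem dist_unfoldStep_le
    (hφ : ∀ m x y, dist (φ.toFun (B.V.tmk m x)) (φ.toFun (B.V.tmk m y)) ≤ dist x y / 3)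
    {f g : X.V ⟶ B.V} {C : ℝ} (h : ∀ x, dist (f.toFun x) (g.toFun x) ≤ C) (x : X.V.carrier) :
    dist ((unfoldStep φ f).toFun x) ((unfoldStep φ g).toFun x) ≤ C / 3 := by
  obtain ⟨m, y, hy⟩ := exists_str_eq_tmk X x
  rw [unfoldStep_apply φ f hy, unfoldStep_apply φ g hy]
  exact (hφ m _ _).trans (div_le_div_of_nonneg_right (h y) (by norm_num))

/-- Two fixed points start within the diameter bound 2, and each application of the operator divides
their uniform distance by 3. -/
theorem eq_of_unfoldStep_eq
    (hφ : ∀ m x y, dist (φ.toFun (B.V.tmk m x)) (φ.toFun (B.V.tmk m y)) ≤ dist x y / 3)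
    (hB : ∀ x y : B.V.carrier, dist x y ≤ 2) {f g : X.V ⟶ B.V}
    (hf : unfoldStep φ f = f) (hg : unfoldStep φ g = g) : f = g := by
  have key : ∀ (n : ℕ) x, dist (f.toFun x) (g.toFun x) ≤ 2 * (1 / 3) ^ n := by
    intro n
    induction n with
    | zero => intro x; simpa using hB _ _
    | succ n ih =>
      intro x
      have h := dist_unfoldStep_le φ hφ ih x
      rw [hf, hg] at h
      refine h.trans (le_of_eq ?_)
      ring
  ext x
  refine dist_le_zero.1 (ge_of_tendsto' (x := Filter.atTop) ?_ fun n => key n x)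
  have h := (tendsto_pow_atTop_nhds_zero_of_lt_one (by norm_num : (0 : ℝ) ≤ 1 / 3)
    (by norm_num)).const_mul 2
  rwa [mul_zero] at h

/-- Picard iteration, carried out pointwise: the increments are dominated by a geometric series, so
no metric on the set of morphisms is needed. -/
theorem exists_unfoldStep_eq [CompleteSpace B.V.carrier]
    (hφ : ∀ m x y, dist (φ.toFun (B.V.tmk m x)) (φ.toFun (B.V.tmk m y)) ≤ dist x y / 3)
    (hB : ∀ x y : B.V.carrier, dist x y ≤ 2) : ∃ f : X.V ⟶ B.V, unfoldStep φ f = f := by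
  -- Any morphism can start the iteration, and one always exists because only the values on the
  -- boundary are prescribed.
  let f : ℕ → (X.V ⟶ B.V) := fun n => (unfoldStep φ)^[n] (someHom X.V B.V)
  have hsucc : ∀ n, f (n + 1) = unfoldStep φ (f n) :=
    fun n => Function.iterate_succ_apply' _ _ _
  have hstep : ∀ (n : ℕ) x, dist ((f n).toFun x) ((f (n + 1)).toFun x) ≤ 2 * (1 / 3) ^ n := by
    intro n
    induction n with
    | zero => intro x; simpa using hB _ _
    | succ n ih =>
      intro x
      have h := dist_unfoldStep_le φ hφ ih x
      rw [← hsucc, ← hsucc] at h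
      refine h.trans (le_of_eq ?_)
      ring
  have hlim : ∀ x, ∃ b, Filter.Tendsto (fun n => (f n).toFun x) Filter.atTop (nhds b) := fun x =>
    cauchySeq_tendsto_of_complete
      (cauchySeq_of_le_geometric _ _ (by norm_num) fun n => hstep n x)
  choose g hg using hlim
  -- All iterates are morphisms, so on the boundary the sequence is constant.
  have hgS : ∀ z, g (X.V.S z) = B.V.S z := fun z => by
    refine tendsto_nhds_unique (hg _) ?_
    simp only [SquaSet.Hom.map_S]
    exact tendsto_const_nhds
  refine ⟨⟨g, hgS⟩, ?_⟩
  ext x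
  obtain ⟨m, y, hy⟩ := exists_str_eq_tmk X x
  rw [unfoldStep_apply φ _ hy]
  -- Continuity along the single copy `m` suffices, so `M ⊗ B` needs no topology here.
  have hcont : Continuous fun b => φ.toFun (B.V.tmk m b) :=
    (LipschitzWith.of_dist_le_mul (K := 1) fun a b => by
      have h0 : 0 ≤ dist a b := dist_nonneg
      have h := hφ m a b
      rw [NNReal.coe_one, one_mul]
      linarith).continuous
  -- The shifted sequence `f (n + 1) x = φ (m ⊗ f n y)` tends to `φ (m ⊗ g y)` by continuity and to
  -- `g x` by construction.
  refine tendsto_nhds_unique ((hcont.tendsto (g y)).comp (hg y)) ?_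
  refine ((hg x).comp (Filter.tendsto_add_atTop_nat 1)).congr fun n => ?_
  simp only [Function.comp_apply, hsucc]
  exact unfoldStep_apply φ _ hy

/-- A coalgebra with invertible structure whose inverse is contractive on each copy of a complete
bounded metric space is final. -/
theorem nonempty_isTerminal_of_contracting [CompleteSpace B.V.carrier]
    (h₁ : B.str ≫ φ = 𝟙 _) (h₂ : φ ≫ B.str = 𝟙 _)
    (hφ : ∀ m x y, dist (φ.toFun (B.V.tmk m x)) (φ.toFun (B.V.tmk m y)) ≤ dist x y / 3)
    (hB : ∀ x y : B.V.carrier, dist x y ≤ 2) : Nonempty (Limits.IsTerminal B) := by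
  choose f hf using fun X : Endofunctor.Coalgebra SquaSet.tensor =>
    exists_unfoldStep_eq (X := X) φ hφ hB
  refine ⟨Limits.IsTerminal.ofUniqueHom (fun X => ⟨f X, ?_⟩) fun X g => ?_⟩
  · conv_rhs => rw [← hf X, unfoldStep, Category.assoc, Category.assoc, h₂, Category.comp_id]
  -- Conversely, the square of a coalgebra morphism composed with `φ` is the fixed point equation.
  · refine Endofunctor.Coalgebra.Hom.ext (eq_of_unfoldStep_eq φ hφ hB ?_ (hf X))
    rw [unfoldStep, ← Category.assoc, g.h, Category.assoc, h₁, Category.comp_id]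

end Terminal

/-! ### The carpet and the completion as final coalgebras -/

theorem nonempty_isTerminal_carpetCoalgebra : Nonempty (Limits.IsTerminal carpetCoalgebra) := by
  -- The maximum metric of the plane serves here; it need not make the carpet a square metric space.
  let _ : MetricSpace carpetCoalgebra.V.carrier := inferInstanceAs (MetricSpace carpet)
  have : CompactSpace carpet := isCompact_iff_compactSpace.1 carpet_spec.2.1
  have : CompleteSpace carpetCoalgebra.V.carrier := inferInstanceAs (CompleteSpace carpet)
  refine nonempty_isTerminal_of_contracting (B := carpetCoalgebra) tau (IsIso.inv_hom_id tau)
    (IsIso.hom_inv_id tau) (fun m x y => dist_contract m x.1 y.1) fun x y => ?_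
  obtain ⟨⟨_, _⟩, _, _⟩ := carpet_spec.2.2.1 x.2
  obtain ⟨⟨_, _⟩, _, _⟩ := carpet_spec.2.2.1 y.2
  change dist x.1 y.1 ≤ 2
  rw [Prod.dist_eq, Real.dist_eq, Real.dist_eq]
  exact max_le (abs_le.2 ⟨by linarith, by linarith⟩) (abs_le.2 ⟨by linarith, by linarith⟩)

theorem SquaMS.nonempty_isTerminal_completionCoalgebra {G : Endofunctor.Algebra SquaMS.tensor}
    (hG : Limits.IsInitial G) :
    Nonempty (Limits.IsTerminal
      (SquaMS.forgetCoalgebra (SquaMS.completionCoalgebra hG))) := by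
  let Q := SquaMS.completionCoalgebra hG
  -- The inverse of `γ`: the isomorphism `δ` followed by `C(η)`, with `η` invertible by Lambek's
  -- lemma.
  let ψ : SquaMS.tensor.obj Q.V ⟶ Q.V := G.a.delta ≫ SquaMS.completion.map G.str
  have h₁ : Q.str ≫ ψ = 𝟙 _ := by
    change (SquaMS.completion.map (Endofunctor.Algebra.Initial.strInv hG) ≫ inv G.a.delta) ≫
      G.a.delta ≫ SquaMS.completion.map G.str = _
    rw [Category.assoc, IsIso.inv_hom_id_assoc, ← Functor.map_comp,
      Endofunctor.Algebra.Initial.left_inv]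
    exact SquaMS.completion.map_id _
  have h₂ : ψ ≫ Q.str = 𝟙 _ := by
    change (G.a.delta ≫ SquaMS.completion.map G.str) ≫
      SquaMS.completion.map (Endofunctor.Algebra.Initial.strInv hG) ≫ inv G.a.delta = _
    rw [Category.assoc, ← Functor.map_comp_assoc,
      Endofunctor.Algebra.Initial.right_inv, SquaMS.completion.map_id, Category.id_comp]
    exact IsIso.hom_inv_id _
  let _ : MetricSpace (SquaMS.forgetCoalgebra Q).V.carrier :=
    inferInstanceAs (MetricSpace Q.V.carrier)
  have : CompleteSpace (SquaMS.forgetCoalgebra Q).V.carrier :=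
    inferInstanceAs (CompleteSpace (UniformSpace.Completion G.a.carrier))
  refine nonempty_isTerminal_of_contracting (B := SquaMS.forgetCoalgebra Q)
    (SquaMS.forgetMetric.map ψ) ?_ ?_ (fun m x y => ?_) Q.V.dist_le_two
  · exact (SquaMS.forgetMetric.map_comp Q.str ψ).symm.trans
      ((congrArg _ h₁).trans (SquaMS.forgetMetric.map_id _))
  · exact (SquaMS.forgetMetric.map_comp ψ Q.str).symm.trans
      ((congrArg _ h₂).trans (SquaMS.forgetMetric.map_id _))
  -- The factor 1/3 comes entirely from the metric of `M ⊗ Q`; `ψ` itself is merely short.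
  · exact (ψ.short _ _).trans (Q.V.pathDist_same_le m x y)

/-! ## The initial algebra -/

/-- The points reached from the boundary of the square by finitely many contractions. -/
inductive Reachable : ℝ × ℝ → Prop
  | boundary (z : M0) : Reachable z
  | contract (m : Idx) {p : ℝ × ℝ} : Reachable p → Reachable (contract m p)

theorem Reachable.mem_carpet {p : ℝ × ℝ} (h : Reachable p) : p ∈ carpet := by
  induction h with
  | boundary z => exact boundary_subset_carpet z.2
  | contract m _ ih => exact contract_mem_carpet m ih

/-- A coordinate `(k + x) / 3` with `k ≤ 2` reaches 0 only for `k = x = 0` and 1 only for `k = 2`,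
`x = 1`. Hence a construction that ends on the boundary stays on it throughout. -/
theorem mem_boundary_of_contract_mem {m : Idx} {p : ℝ × ℝ} (hp : p ∈ unitSquare)
    (h : contract m p ∈ boundary) : p ∈ boundary := by
  obtain ⟨⟨i, j⟩, hm⟩ := m
  have key : ∀ (k : Fin 3) {x : ℝ}, x ∈ Set.Icc (0 : ℝ) 1 →
      (((k : ℕ) : ℝ) / 3 + x / 3 = 0 ∨ ((k : ℕ) : ℝ) / 3 + x / 3 = 1) → x = 0 ∨ x = 1 := by
    rintro k x ⟨h0, h1⟩ h
    have hk : ((k : ℕ) : ℝ) ≤ 2 := by exact_mod_cast Nat.le_of_lt_succ k.2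
    have hk0 : (0 : ℝ) ≤ ((k : ℕ) : ℝ) := Nat.cast_nonneg _
    rcases h with h | h
    · exact Or.inl (by linarith)
    · exact Or.inr (by linarith)
  rcases h with ⟨h, -⟩ | ⟨-, h⟩
  · exact Or.inl ⟨key i hp.1 h, hp.2⟩
  · exact Or.inr ⟨hp.1, key j hp.2 h⟩

/-- The reachable points as a square set. -/
def reachObj : SquaSet where
  carrier := {p : ℝ × ℝ // Reachable p}
  S z := ⟨z, .boundary z⟩
  S_injective _ _ h := Subtype.ext (congrArg (fun a : {p : ℝ × ℝ // Reachable p} => a.1) h)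

/-- The map `m ⊗ p ↦ σ_m(p)` on reachable points. -/
def reachStr : reachObj.tensorObj ⟶ reachObj where
  toFun := Quotient.lift
    (fun p : Idx × reachObj.carrier => (⟨contract p.1 p.2.1, .contract p.1 p.2.2⟩ :
      reachObj.carrier)) (by
    rintro ⟨m, x⟩ ⟨n, y⟩ h
    rcases reachObj.glueSetoid_iff.1 h with h | ⟨z, w, h1, h2, h3⟩
    · rw [h]
    · simp only at h1 h2
      subst h1 h2
      exact Subtype.ext h3)
  map_S z := Subtype.ext (contract_localOf z)

/-! ### Evaluation and initiality among square sets -/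

/-- The evaluation of reachable points in an algebra, as a relation. -/
inductive Eval {A : SquaSet} (α : A.tensorObj ⟶ A) : ℝ × ℝ → A.carrier → Prop
  | boundary (z : M0) : Eval α z (A.S z)
  | contract (m : Idx) {p : ℝ × ℝ} {a : A.carrier} :
      Eval α p a → Eval α (contract m p) (α.toFun (A.tmk m a))

namespace Eval

variable {A : SquaSet} {α : A.tensorObj ⟶ A}

theorem reachable {p : ℝ × ℝ} {a : A.carrier} (h : Eval α p a) : Reachable p := by
  induction h with
  | boundary z => exact .boundary z
  | contract m _ ih => exact .contract m ih

/-- If `σ_m p` lies on the boundary, so does `p`, and `m ⊗ S_A(p)` is the designated boundary point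
`S_{M ⊗ A}(σ_m p)`, which `α` preserves. -/
theorem eq_S {p : ℝ × ℝ} {a : A.carrier} (h : Eval α p a) (hp : p ∈ SquareSets.boundary) :
    a = A.S ⟨p, hp⟩ := by
  induction h with
  | boundary z => rfl
  | @contract m p a h ih =>
    have hp' := mem_boundary_of_contract_mem (carpet_spec.2.2.1 h.reachable.mem_carpet) hp
    rw [ih hp', ← α.map_S ⟨_, hp⟩]
    exact congrArg α.toFun (A.tensorS_eq (w := ⟨p, hp'⟩) rfl).symm

/-- Off the boundary both derivations end with a contraction. Injectivity of `τ` compares these last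
steps: either they coincide and induction applies, or they are glued boundary points, whose images
in `M ⊗ A` agree. -/
theorem unique {p : ℝ × ℝ} {a b : A.carrier} (ha : Eval α p a) (hb : Eval α p b) : a = b := by
  by_cases hp : p ∈ SquareSets.boundary
  · rw [ha.eq_S hp, hb.eq_S hp]
  induction ha generalizing b with
  | boundary z => exact absurd z.2 hp
  | @contract m p a ha ih =>
    -- Case analysis on `hb` needs a variable as index; the equation is kept in `hq`.
    generalize hq : SquareSets.contract m p = q at hb
    cases hb with
    | boundary z => exact absurd (hq ▸ z.2) hp
    | @contract n q b hb =>
      have h : tau.toFun (carpetObj.tmk m ⟨p, ha.reachable.mem_carpet⟩) =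
          tau.toFun (carpetObj.tmk n ⟨q, hb.reachable.mem_carpet⟩) := Subtype.ext hq
      rcases carpetObj.tmk_eq_iff.1 (tau_bijective.1 h) with ⟨rfl, e⟩ | ⟨z, w, h1, h2, h3⟩
      · obtain rfl : p = q := congrArg Subtype.val e
        -- The induction hypothesis covers only points off the boundary, and `p` may lie on it
        -- although `σ_m p` does not.
        by_cases hp' : p ∈ SquareSets.boundary
        · rw [ha.eq_S hp', hb.eq_S hp']
        · rw [ih hb hp']
      · obtain rfl : p = z := congrArg Subtype.val h1
        obtain rfl : q = w := congrArg Subtype.val h2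
        rw [ha.eq_S z.2, hb.eq_S w.2]
        exact congrArg α.toFun (A.tmk_eq_iff.2 (Or.inr ⟨z, w, rfl, rfl, h3⟩))

/-- `Reachable` is a proposition, so data cannot be defined by recursion on it. Hence the detour
through a relation that is total and single-valued. -/
theorem exists_of_reachable {p : ℝ × ℝ} (h : Reachable p) : ∃ a, Eval α p a := by
  induction h with
  | boundary z => exact ⟨_, .boundary z⟩
  | contract m _ ih => exact ⟨_, .contract m ih.choose_spec⟩

end Eval

/-- The evaluation of reachable points in an algebra. -/
def fold {A : SquaSet} (α : A.tensorObj ⟶ A) : reachObj ⟶ A where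
  toFun p := (Eval.exists_of_reachable (α := α) p.2).choose
  map_S z := (Eval.exists_of_reachable (α := α) (reachObj.S z).2).choose_spec.unique (.boundary z)

theorem eval_fold {A : SquaSet} (α : A.tensorObj ⟶ A) (p : reachObj.carrier) :
    Eval α p.1 ((fold α).toFun p) :=
  (Eval.exists_of_reachable (α := α) p.2).choose_spec

theorem fold_reachStr {A : SquaSet} (α : A.tensorObj ⟶ A) (m : Idx) (p : reachObj.carrier) :
    (fold α).toFun (reachStr.toFun (reachObj.tmk m p)) = α.toFun (A.tmk m ((fold α).toFun p)) :=
  (eval_fold α _).unique (.contract m (eval_fold α p))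

/-- The graph of `f` satisfies the rules defining `Eval`, so it lies in the graph of `fold`. -/
theorem eq_fold {A : SquaSet} (α : A.tensorObj ⟶ A) (f : reachObj ⟶ A)
    (hf : ∀ m p, f.toFun (reachStr.toFun (reachObj.tmk m p)) = α.toFun (A.tmk m (f.toFun p))) :
    f = fold α := by
  have key : ∀ p (hp : Reachable p), Eval α p (f.toFun ⟨p, hp⟩) := by
    intro p hp
    induction hp with
    | boundary z =>
      have h : f.toFun ⟨z, .boundary z⟩ = A.S z := f.map_S z
      exact h ▸ .boundary z
    | @contract m p hp ih =>
      have h : f.toFun ⟨contract m p, .contract m hp⟩ = α.toFun (A.tmk m (f.toFun ⟨p, hp⟩)) :=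
        hf m ⟨p, hp⟩
      exact h ▸ .contract m ih
  ext p
  exact (key p.1 p.2).unique (eval_fold α p)

/-! ### The metric on reachable points and the initial algebra -/

/-- The carpet with the taxicab metric. -/
def taxiCarpet : SquaMS where
  toSquaSet := carpetObj
  metric :=
    { dist := fun p q => taxi p.1 q.1
      dist_self := fun p => by simp [taxi]
      dist_comm := fun p q => SquaMS.taxi_comm _ _
      dist_triangle := fun p q r => SquaMS.taxi_triangle _ _ _
      eq_of_dist_eq_zero := fun h => Subtype.ext (SquaMS.eq_of_taxi_eq_zero h) }
  dist_le_two p q := SquaMS.taxi_le_two (carpet_spec.2.2.1 p.2) (carpet_spec.2.2.1 q.2)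
  sq1_left r s := by change taxi (left r) (left s) = _; simp [taxi, left, abs_sub_comm]
  sq1_right r s := by change taxi (right r) (right s) = _; simp [taxi, right, abs_sub_comm]
  sq1_bottom r s := by change taxi (bottom r) (bottom s) = _; simp [taxi, bottom, abs_sub_comm]
  sq1_top r s := by change taxi (top r) (top s) = _; simp [taxi, top, abs_sub_comm]
  sq2 _ _ := le_rfl

/-- The carpet with the taxicab metric as an algebra. -/
def taxiCarpetAlgebra : Endofunctor.Algebra SquaMS.tensor where
  a := taxiCarpet
  str :=
    { toHom := tau
      short := taxiCarpet.tensor_short (Z := taxiCarpet.carrier) tau.toFun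
        (fun m x y => (SquaMS.taxi_contract m x.1 y.1).le)
        (fun _ _ => taxiCarpet.dist_le_two _ _) }

/-- The inclusion of the reachable points into the carpet commutes with the structure maps, so it is
the evaluation. -/
theorem fold_tau (p : reachObj.carrier) :
    (fold tau).toFun p = (⟨p.1, p.2.mem_carpet⟩ : carpet) := by
  have h := eq_fold tau (⟨fun p => (⟨p.1, p.2.mem_carpet⟩ : carpet), fun _ => rfl⟩ :
    SquaSet.Hom reachObj carpetObj) (fun _ _ => rfl)
  rw [← h]

/-- The structure map of an algebra, as a morphism of square sets. -/
def algStr (A : Endofunctor.Algebra SquaMS.tensor) : A.a.toSquaSet.tensorObj ⟶ A.a.toSquaSet :=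
  A.str.toHom

/-- The distance of the images of two reachable points in an algebra. -/
def algDist (A : Endofunctor.Algebra SquaMS.tensor) (p q : reachObj.carrier) : ℝ :=
  dist ((fold (algStr A)).toFun p) ((fold (algStr A)).toFun q)

theorem algDist_le_two (A : Endofunctor.Algebra SquaMS.tensor) (p q : reachObj.carrier) :
    algDist A p q ≤ 2 := A.a.dist_le_two _ _

/-- The largest distance of the images of two reachable points in an algebra. -/
def reachDist (p q : reachObj.carrier) : ℝ := ⨆ A, algDist A p q

theorem algDist_le_reachDist (A : Endofunctor.Algebra SquaMS.tensor) (p q : reachObj.carrier) :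
    algDist A p q ≤ reachDist p q :=
  -- The algebras form a large type, but the supremum is one of real numbers. The bound 2 common to
  -- all square metric spaces makes it meaningful.
  le_ciSup (f := fun A => algDist A p q)
    ⟨2, by rintro _ ⟨A, rfl⟩; exact algDist_le_two A p q⟩ A

theorem reachDist_le {p q : reachObj.carrier} {C : ℝ} (h : ∀ A, algDist A p q ≤ C) :
    reachDist p q ≤ C :=
  -- A supremum of reals over an empty family would be the default value 0, whatever `C` is.
  haveI : Nonempty (Endofunctor.Algebra SquaMS.tensor) := ⟨taxiCarpetAlgebra⟩
  ciSup_le h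

/-- The taxicab carpet is one of the competing algebras, and evaluation in it is the inclusion. This
yields both separation of points and the axiom `sq2`. -/
theorem taxi_le_reachDist (p q : reachObj.carrier) : taxi p.1 q.1 ≤ reachDist p q := by
  refine le_trans (le_of_eq ?_) (algDist_le_reachDist taxiCarpetAlgebra p q)
  change _ = taxi ((fold tau).toFun p).1 ((fold tau).toFun q).1
  rw [fold_tau, fold_tau]

theorem algDist_S (A : Endofunctor.Algebra SquaMS.tensor) (z w : M0) :
    algDist A (reachObj.S z) (reachObj.S w) = dist (A.a.S z) (A.a.S w) := by
  rw [algDist, SquaSet.Hom.map_S, SquaSet.Hom.map_S]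

/-- Along a side the axioms `sq1` prescribe the same distance in every algebra, so the supremum
inherits them. -/
theorem reachDist_S_eq {z w : M0} {r : ℝ} (h : taxi z w = r)
    (hA : ∀ A : SquaMS, dist (A.S z) (A.S w) = r) :
    reachDist (reachObj.S z) (reachObj.S w) = r :=
  le_antisymm (reachDist_le fun A => ((algDist_S A z w).trans (hA A.a)).le)
    (h.symm.le.trans (taxi_le_reachDist (reachObj.S z) (reachObj.S w)))

/-- The reachable points with the largest metric induced by algebras. -/
def reachMS : SquaMS where
  toSquaSet := reachObj
  metric :=
    { dist := reachDist
      dist_self := fun p => le_antisymm (reachDist_le fun A => (dist_self _).le)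
        ((SquaMS.taxi_nonneg _ _).trans (taxi_le_reachDist p p))
      dist_comm := fun p q => iSup_congr fun A => dist_comm _ _
      dist_triangle := fun p q r => reachDist_le fun A => (dist_triangle _ _ _).trans
        (add_le_add (algDist_le_reachDist A p q) (algDist_le_reachDist A q r))
      eq_of_dist_eq_zero := fun {p q} h => Subtype.ext (SquaMS.eq_of_taxi_eq_zero
        (le_antisymm ((taxi_le_reachDist p q).trans h.le) (SquaMS.taxi_nonneg _ _))) }
  dist_le_two p q := reachDist_le fun A => algDist_le_two A p q
  sq1_left r s := reachDist_S_eq (by simp [taxi, left, abs_sub_comm]) fun A => A.sq1_left r s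
  sq1_right r s := reachDist_S_eq (by simp [taxi, right, abs_sub_comm]) fun A => A.sq1_right r s
  sq1_bottom r s :=
    reachDist_S_eq (by simp [taxi, bottom, abs_sub_comm]) fun A => A.sq1_bottom r s
  sq1_top r s := reachDist_S_eq (by simp [taxi, top, abs_sub_comm]) fun A => A.sq1_top r s
  sq2 z w := taxi_le_reachDist (reachObj.S z) (reachObj.S w)

/-- Each algebra contributes at most a third: its structure map is short and its copies are scaled
by 1/3. Through `tensor_short` this makes the structure map of the reachable points short. -/
theorem reachDist_reachStr_le (m : Idx) (p q : reachObj.carrier) :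
    reachDist (reachStr.toFun (reachObj.tmk m p)) (reachStr.toFun (reachObj.tmk m q)) ≤
      reachDist p q / 3 := by
  refine reachDist_le fun A => ?_
  rw [algDist, fold_reachStr, fold_reachStr]
  refine (A.str.short _ _).trans ((A.a.pathDist_same_le m _ _).trans ?_)
  exact div_le_div_of_nonneg_right (algDist_le_reachDist A p q) (by norm_num)

/-- The algebra of reachable points. -/
def reachAlgebra : Endofunctor.Algebra SquaMS.tensor where
  a := reachMS
  str :=
    { toHom := reachStr
      short := reachMS.tensor_short (Z := reachMS.carrier) reachStr.toFun reachDist_reachStr_le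
        (fun _ _ => reachMS.dist_le_two _ _) }

/-- The algebra morphism from the reachable points to an algebra. -/
def foldHom (A : Endofunctor.Algebra SquaMS.tensor) : reachAlgebra ⟶ A where
  -- Shortness is built into the metric, which dominates the distance evaluated in `A`.
  f := { toHom := fold (algStr A), short := algDist_le_reachDist A }
  h := by
    refine SquaMS.hom_ext fun a => ?_
    induction a using Quotient.inductionOn with | h p => ?_
    exact (fold_reachStr (algStr A) p.1 p.2).symm

theorem nonempty_isInitial_reachAlgebra : Nonempty (Limits.IsInitial reachAlgebra) := by
  refine ⟨Limits.IsInitial.ofUniqueHom foldHom fun A g => Endofunctor.Algebra.Hom.ext ?_⟩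
  refine SquaMS.hom_ext fun p => ?_
  -- Uniqueness already holds among square sets; the commuting square of `g`, evaluated at `m ⊗ p`,
  -- is what `eq_fold` requires.
  have h := eq_fold (algStr A) g.f.toHom fun m p => by
    have h := g.h
    exact (congrArg (fun k : SquaMS.tensor.obj reachAlgebra.a ⟶ A.a =>
      k.toFun (reachObj.tmk m p)) h).symm
  exact congrArg (fun k : reachObj ⟶ A.a.toSquaSet => k.toFun p) h

end

end SquareSets

theorem mainTheorem7 :
    Nonempty (CategoryTheory.Limits.IsTerminal SquareSets.carpetCoalgebra) ∧
      (∃ G : CategoryTheory.Endofunctor.Algebra SquareSets.SquaMS.tensor,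
        Nonempty (CategoryTheory.Limits.IsInitial G)) ∧
      ∀ (G : CategoryTheory.Endofunctor.Algebra SquareSets.SquaMS.tensor)
        (hG : CategoryTheory.Limits.IsInitial G),
        Nonempty (CategoryTheory.Limits.IsTerminal
          (SquareSets.SquaMS.forgetCoalgebra (SquareSets.SquaMS.completionCoalgebra hG))) :=
  ⟨SquareSets.nonempty_isTerminal_carpetCoalgebra,
    ⟨SquareSets.reachAlgebra, SquareSets.nonempty_isInitial_reachAlgebra⟩,
    fun _ hG => SquareSets.SquaMS.nonempty_isTerminal_completionCoalgebra hG⟩
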